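/- Let $V$ be a finite set and $\mathcal C$ a family of subsets (members) of $V$. $\mathcal C$ is a clutter if no member contains another one. It is ideal if, for every $w\in\mathbb Z_{\ge 0}^V$, the linear program $\min\{w^\top x : x\in\mathbb R_{\ge 0}^V,\ \sum_{u\in C}x_u\ge 1\ \forall C\in\mathcal C\}$ has an integral optimal solution. It is $k$-wise intersecting if every subset of at most $k$ members have a common element, yet no element belongs to all members. It is binary if the symmetric difference of any odd number of members contains a member. For a finite set $E$ and $S\subseteq\{0,1\}^E$, the cuboid of $S$ is the clutter over the ground set $E\times\{0,1\}$ with members $\{(e,p_e):e\in E\}$, $p\in S$. The cycle space of a graph $G=(V,E)$ is the set of the incidence vectors in $\{0,1\}^E$ of all $J\subseteq E$ such that every vertex is incident with an even number of edges in $J$. For a set $T$ of vertices, a $T$-join is a set $J\subseteq E$ such that $T$ is the set of the vertices incident with an odd number of edges in $J$. Proposition. There exists an ideal $3$-wise intersecting binary clutter. More precisely, the cuboid of the cycle space of the Petersen graph is an ideal $3$-wise intersecting binary clutter. This cuboid is Schrijver's clutter $T_{30}$: if $H$ is the graph obtained from the Petersen graph by subdividing every edge once, and $T$ is any set of an even number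 of vertices of $H$ that contains all the new vertices, then the clutter of the (inclusionwise) minimal $T$-joins of $H$ is, up to a relabelling of the ground set, the cuboid of the cycle space of the Petersen graph. In particular, the statement "every $3$-wise intersecting binary clutter is non-ideal" is false. -/

import Mathlib

namespace Clutters

open Finset

/-! ### Clutters over a finite ground set `V`, given by the family of their members -/

section Basic

variable {V W : Type*}

/-- No member contains another one. -/
def IsClutter (C : Set (Finset V)) : Prop :=
  IsAntichain (· ⊆ ·) C

/-- Feasible solutions of the covering linear program
`min wᵀx` subject to `∑ (x_u : u ∈ A) ≥ 1` for every member `A`, `x ≥ 0`. -/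
def IsFeasible (C : Set (Finset V)) (x : V → ℝ) : Prop :=
  (∀ v, 0 ≤ x v) ∧ ∀ A ∈ C, 1 ≤ ∑ v ∈ A, x v

/-- The covering linear program has an integral optimal solution for every cost vector
`w` with nonnegative integer entries. -/
def IsIdeal [Fintype V] (C : Set (Finset V)) : Prop :=
  ∀ w : V → ℕ, ∃ x : V → ℝ, IsFeasible C x ∧ (∀ v, ∃ m : ℤ, x v = m) ∧
    ∀ y : V → ℝ, IsFeasible C y → ∑ v, (w v : ℝ) * x v ≤ ∑ v, (w v : ℝ) * y v

/-- Every subset of at most `k` members has a common element, yet no element belongs to all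
members. (The empty subfamily has a common element exactly when the ground set is nonempty, so
the family without members is never `k`-wise intersecting.) -/
def IsKWiseIntersecting (k : ℕ) (C : Set (Finset V)) : Prop :=
  (∀ D : Finset (Finset V), (D : Set (Finset V)) ⊆ C → #D ≤ k → ∃ v, ∀ A ∈ D, v ∈ A) ∧
    ¬ ∃ v, ∀ A ∈ C, v ∈ A

/-- The symmetric difference of the sets in `D`: the elements that lie in an odd number of
them. -/
def symmDiffAll [Fintype V] [DecidableEq V] (D : Finset (Finset V)) : Finset V :=
  {v | Odd #{A ∈ D | v ∈ A}}

/-- The symmetric difference of any odd number of members contains a member. -/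
def IsBinary [Fintype V] [DecidableEq V] (C : Set (Finset V)) : Prop :=
  ∀ D : Finset (Finset V), (D : Set (Finset V)) ⊆ C → Odd #D → ∃ A ∈ C, A ⊆ symmDiffAll D

/-- `D` is obtained from `C` by a relabelling of the ground set. -/
def IsRelabelling (C : Set (Finset V)) (D : Set (Finset W)) : Prop :=
  ∃ f : V ≃ W, D = (fun A : Finset V => A.map f.toEmbedding) '' C

end Basic

/-- The cuboid of a set `S` of 0-1 points with coordinates indexed by `E`. The two elements
`(e, true)` and `(e, false)` of the ground set stand for the positions of `p_e` and `1 - p_e`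
in the incidence vector of the member that comes from the point `p`. -/
def cuboid {E : Type*} [Fintype E] (S : Set (E → Bool)) : Set (Finset (E × Bool)) :=
  {A | ∃ p ∈ S, A = ({x | p x.1 = x.2} : Finset (E × Bool))}

/-! ### Graphs -/

section Graphs

variable {V : Type*} [DecidableEq V]

/-- The number of edges in `J` incident with `v`. -/
def degreeIn (G : SimpleGraph V) (J : Finset G.edgeSet) (v : V) : ℕ :=
  #(J.filter fun e => v ∈ e.1)

/-- The 0-1 incidence vectors of the cycles of `G`, a cycle being a set of edges such that every
vertex is incident with an even number of them. -/
def cycleSpace (G : SimpleGraph V) : Set (G.edgeSet → Bool) :=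
  {p | ∃ J : Finset G.edgeSet, (∀ v, Even (degreeIn G J v)) ∧ p = fun e => decide (e ∈ J)}

/-- `J` is a `T`-join: the vertices of odd degree in `J` are exactly those in `T`. -/
def IsTJoin (G : SimpleGraph V) (T : Finset V) (J : Finset G.edgeSet) : Prop :=
  ∀ v, Odd (degreeIn G J v) ↔ v ∈ T

/-- The family of inclusionwise minimal `T`-joins, over the ground set of the edges of `G`. -/
def minimalTJoins (G : SimpleGraph V) (T : Finset V) : Set (Finset G.edgeSet) :=
  {J | Minimal (IsTJoin G T) J}

end Graphs

/-- The graph obtained from `G` by subdividing every edge once: the new vertex `Sum.inr e` is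
adjacent to exactly the two ends of the edge `e`. -/
def subdivision {V : Type*} (G : SimpleGraph V) : SimpleGraph (V ⊕ G.edgeSet) where
  Adj
    | .inl v, .inr e => v ∈ (e : Sym2 V)
    | .inr e, .inl v => v ∈ (e : Sym2 V)
    | _, _ => False
  symm := ⟨by rintro (a | a) (b | b) h <;> exact h⟩
  loopless := ⟨by rintro (a | a) h <;> exact h⟩

instance {V : Type*} [DecidableEq V] (G : SimpleGraph V) : DecidableRel (subdivision G).Adj
  | .inl _, .inl _ => isFalse id
  | .inl v, .inr e => inferInstanceAs (Decidable (v ∈ (e : Sym2 V)))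
  | .inr e, .inl v => inferInstanceAs (Decidable (v ∈ (e : Sym2 V)))
  | .inr _, .inr _ => isFalse id

/-- The Petersen graph: an outer 5-cycle on the vertices `(false, i)`, an inner pentagram on the
vertices `(true, i)`, and the five spokes joining `(false, i)` to `(true, i)`. -/
def petersen : SimpleGraph (Bool × Fin 5) where
  Adj u v :=
    (u.1 = false ∧ v.1 = false ∧ (v.2 = u.2 + 1 ∨ u.2 = v.2 + 1)) ∨
    (u.1 = true ∧ v.1 = true ∧ (v.2 = u.2 + 2 ∨ u.2 = v.2 + 2)) ∨
    (u.1 ≠ v.1 ∧ u.2 = v.2)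
  symm := ⟨by decide⟩
  loopless := ⟨by decide⟩

instance : DecidableRel petersen.Adj := fun u v =>
  inferInstanceAs (Decidable
    ((u.1 = false ∧ v.1 = false ∧ (v.2 = u.2 + 1 ∨ u.2 = v.2 + 1)) ∨
    (u.1 = true ∧ v.1 = true ∧ (v.2 = u.2 + 2 ∨ u.2 = v.2 + 2)) ∨
    (u.1 ≠ v.1 ∧ u.2 = v.2)))

end Clutters

namespace Clutters

open Finset

set_option linter.unusedSectionVars false

/-! ### Edge sets modulo two in multigraphs: boundaries, cuts and reachability -/

section Multigraph

variable {V E : Type*} [DecidableEq V] [DecidableEq E]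

/-! Ideality comes from `T`-joins. In the subdivision every new vertex has degree two and lies in
`T`, so a `T`-join picks exactly one half of each original edge: it is an orientation whose
indegrees have prescribed parities. Two such orientations differ by a cycle, so they form a coset of
the cycle space, nonempty because the graph is connected and `T` is even. Flipping coordinates moves
this coset to the cycle space itself (`isRelabelling_minimalTJoins_cuboid`).

The clutter of minimal `T`-joins is ideal (`isIdeal_minimalTJoins`) because the incidence vector of
a cheapest `T`-odd cut is optimal. The lower bound for fractional solutions follows, by scaling and
rounding, from its integral form for weights `c` that are even on cycles (`mul_le_sum_of_even`).
There, weightless edges are contracted; once none is left, `exists_reducible_vertex` supplies a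
vertex `x` whose star is a `T`-odd cut that can be subtracted from `c` while the minimum weight of a
`T`-join drops by only one. Such an `x` is an end of a path that is shortest when the signs are
reversed on a minimum `T`-join.

Three cycles agree on an edge exactly when two of their pairwise sums both miss it. So the cuboid is
3-wise intersecting because two cycles never cover the Petersen graph, a finite check on a
six-dimensional space (`exists_notMem_two_cycles`), and because no edge is constant on all cycles.
Binarity is closure of the cycle space under addition. -/

/-- The boundary modulo two of a set of edges in the multigraph with end maps `s` and `t`. -/
def boundary (s t : E → V) (A : Finset E) : V → ZMod 2 :=
  ∑ e ∈ A, (Pi.single (s e) 1 + Pi.single (t e) 1)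

/-- The edges of `A` with exactly one end in `U`. -/
def cutEdges (s t : E → V) (A : Finset E) (U : Finset V) : Finset E :=
  {e ∈ A | ¬ (s e ∈ U ↔ t e ∈ U)}

variable {s t : E → V}

lemma add_self_zmodTwo {ι : Type*} (f : ι → ZMod 2) : f + f = 0 := by
  funext i; exact CharTwo.add_self_eq_zero _

lemma boundary_disjUnion {A B : Finset E} (h : Disjoint A B) :
    boundary s t (A ∪ B) = boundary s t A + boundary s t B :=
  sum_union h

lemma boundary_sdiff {A B : Finset E} (h : B ⊆ A) :
    boundary s t (A \ B) = boundary s t A + boundary s t B := by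
  have h1 : boundary s t (A \ B) + boundary s t B = boundary s t A := sum_sdiff h
  rw [← h1, add_assoc, add_self_zmodTwo, add_zero]

lemma boundary_symmDiff (A B : Finset E) :
    boundary s t (symmDiff A B) = boundary s t A + boundary s t B := by
  have h1 : symmDiff A B = (A \ (A ∩ B)) ∪ (B \ (A ∩ B)) := by
    ext e; simp only [mem_symmDiff, mem_union, mem_sdiff, mem_inter]; tauto
  have h2 : Disjoint (A \ (A ∩ B)) (B \ (A ∩ B)) := by
    rw [disjoint_left]; intro e; simp only [mem_sdiff, mem_inter]; tauto
  rw [h1, boundary_disjUnion h2, boundary_sdiff inter_subset_left,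
    boundary_sdiff inter_subset_right, add_add_add_comm, add_self_zmodTwo, add_zero]

lemma boundary_singleton (e : E) :
    boundary s t {e} = Pi.single (s e) 1 + Pi.single (t e) 1 := by
  simp [boundary]

lemma boundary_empty : boundary s t (∅ : Finset E) = 0 := by
  simp [boundary]

lemma boundary_eq_zero_of_loops {A : Finset E} (h : ∀ e ∈ A, s e = t e) :
    boundary s t A = 0 := by
  refine sum_eq_zero fun e he => ?_
  rw [h e he, add_self_zmodTwo]

lemma sum_boundary_mul [Fintype V] (A : Finset E) (f : V → ZMod 2) :
    ∑ v, f v * boundary s t A v = ∑ e ∈ A, (f (s e) + f (t e)) := by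
  simp only [boundary, Finset.sum_apply, mul_sum]
  rw [sum_comm]
  refine sum_congr rfl fun e _ => ?_
  simp [Pi.single_apply, mul_add, sum_add_distrib]

/-- An edge with both ends in `U` is counted twice and cancels. This parity count is what forces
`T`-joins to meet `T`-odd cuts and paths to have a second end. -/
lemma sum_boundary (A : Finset E) (U : Finset V) :
    ∑ v ∈ U, boundary s t A v = (#(cutEdges s t A U) : ZMod 2) := by
  simp only [boundary, Finset.sum_apply]
  rw [sum_comm, cutEdges, card_filter, Nat.cast_sum]
  refine sum_congr rfl fun e _ => ?_
  simp only [Pi.add_apply, sum_add_distrib, Pi.single_apply, sum_ite_eq']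
  by_cases h1 : s e ∈ U <;> by_cases h2 : t e ∈ U <;> simp [h1, h2]
  exact CharTwo.add_self_eq_zero 1

lemma single_add_single_eq_zero {a b : V}
    (h : (Pi.single a 1 + Pi.single b 1 : V → ZMod 2) = 0) : a = b := by
  by_contra hab
  have := congrFun h a
  simp [hab] at this

lemma single_add_cancel (a b c : V) :
    (Pi.single a 1 + Pi.single b 1 + (Pi.single a 1 + Pi.single c 1) : V → ZMod 2) =
      Pi.single b 1 + Pi.single c 1 := by
  have := add_self_zmodTwo (Pi.single a 1 : V → ZMod 2)
  linear_combination (exp := 1) this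

lemma mem_cutEdges {A : Finset E} {U : Finset V} {e : E} :
    e ∈ cutEdges s t A U ↔ e ∈ A ∧ ¬ (s e ∈ U ↔ t e ∈ U) := by
  simp [cutEdges]

lemma exists_other_end {A : Finset E} {x : V} {e : E} (h : e ∈ cutEdges s t A {x}) :
    ∃ o, o ≠ x ∧ (o = s e ∨ o = t e) ∧
      boundary s t {e} = Pi.single x 1 + Pi.single o 1 := by
  simp only [mem_cutEdges, mem_singleton] at h
  rw [boundary_singleton]
  by_cases h1 : s e = x
  · refine ⟨t e, fun h2 => h.2 (by simp [h1, h2]), Or.inr rfl, by rw [h1]⟩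
  · have h2 : t e = x := by tauto
    exact ⟨s e, h1, Or.inl rfl, by rw [h2, add_comm]⟩

open Classical in
/-- The vertices that the edges of `A` connect to `x`. -/
noncomputable def reach [Fintype V] (s t : E → V) (A : Finset E) (x : V) : Finset V :=
  {z | ∃ B ⊆ A, boundary s t B = Pi.single x 1 + Pi.single z 1}

variable [Fintype V]

lemma mem_reach {A : Finset E} {x z : V} :
    z ∈ reach s t A x ↔ ∃ B ⊆ A, boundary s t B = Pi.single x 1 + Pi.single z 1 := by
  simp [reach]

lemma self_mem_reach (A : Finset E) (x : V) : x ∈ reach s t A x :=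
  mem_reach.2 ⟨∅, by simp, by rw [boundary_empty, add_self_zmodTwo]⟩

/-- Toggling `g` in a connecting set moves its far end across `g`. Hence no edge of `A` leaves the
reachable set. -/
lemma reach_closed {A : Finset E} {x : V} {g : E} (hg : g ∈ A) :
    s g ∈ reach s t A x ↔ t g ∈ reach s t A x := by
  have key : ∀ B ⊆ A, symmDiff B {g} ⊆ A := by
    intro B hB e he
    simp only [mem_symmDiff, mem_singleton] at he
    rcases he with he | he
    · exact hB he.1
    · exact he.1 ▸ hg
  simp only [mem_reach]
  constructor
  · rintro ⟨B, hB, h⟩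
    refine ⟨symmDiff B {g}, key B hB, ?_⟩
    rw [boundary_symmDiff, h, boundary_singleton, add_comm (Pi.single x 1), single_add_cancel]
  · rintro ⟨B, hB, h⟩
    refine ⟨symmDiff B {g}, key B hB, ?_⟩
    rw [boundary_symmDiff, h, boundary_singleton, add_comm (Pi.single x 1),
      add_comm (Pi.single (s g) 1), single_add_cancel]

/-- An edge of `D` at `x` lies in a subset of `D` that is either a cycle using one further edge
at `x`, or a path from `x` to some vertex of odd degree in `D`. -/
lemma exists_cycle_or_path {D : Finset E} {x : V} {e : E} (he : e ∈ cutEdges s t D {x}) :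
    (∃ B ⊆ D, ∃ f, f ≠ e ∧ cutEdges s t B {x} = {e, f} ∧ boundary s t B = 0) ∨
    ∃ B ⊆ D, ∃ z, cutEdges s t B {x} = {e} ∧ z ≠ x ∧ boundary s t D z ≠ 0 ∧
      boundary s t B = Pi.single x 1 + Pi.single z 1 := by
  obtain ⟨v, hvx, hve, hbv⟩ := exists_other_end he
  -- `W` is the component of `v`, the other end of `e`, once the edges of `D` at `x` are deleted, so
  -- edges of `D` leaving `W` are all at `x`. A second one closes a cycle with `e`; if there is
  -- none, parity gives `W` a vertex of odd degree in `D`.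
  set R := D \ cutEdges s t D {x} with hR
  set W := reach s t R v with hW
  have hcutR : ∀ A ⊆ R, cutEdges s t A {x} = ∅ := by
    intro A hA
    rw [eq_empty_iff_forall_notMem]
    intro g hg
    have h1 := mem_sdiff.1 (hA (mem_cutEdges.1 hg).1)
    exact h1.2 (mem_cutEdges.2 ⟨h1.1, (mem_cutEdges.1 hg).2⟩)
  have hxW : x ∉ W := by
    intro hx
    obtain ⟨A, hA, hbA⟩ := mem_reach.1 hx
    have h1 := sum_boundary (s := s) (t := t) A {x}
    rw [hcutR A hA, hbA] at h1
    simp [Pi.single_apply, hvx.symm] at h1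
  have hcut : ∀ g ∈ cutEdges s t D W, g ∈ cutEdges s t D {x} := by
    intro g hg
    by_contra hgx
    have h1 := mem_cutEdges.1 hg
    exact h1.2 (reach_closed (mem_sdiff.2 ⟨h1.1, hgx⟩))
  have hsub : ∀ A ⊆ R, ∀ F ⊆ cutEdges s t D {x}, A ∪ F ⊆ D := by
    intro A hA F hF
    exact union_subset (hA.trans sdiff_subset) (hF.trans (filter_subset _ _))
  have hdisj : ∀ A ⊆ R, ∀ F ⊆ cutEdges s t D {x}, Disjoint A F := by
    intro A hA F hF
    exact disjoint_of_subset_left hA (disjoint_of_subset_right hF sdiff_disjoint)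
  have hcutU : ∀ A ⊆ R, ∀ F ⊆ cutEdges s t D {x}, cutEdges s t (A ∪ F) {x} = F := by
    intro A hA F hF
    have h1 : cutEdges s t (A ∪ F) {x} = cutEdges s t A {x} ∪ cutEdges s t F {x} := by
      simp [cutEdges, filter_union]
    rw [h1, hcutR A hA, empty_union]
    exact filter_true_of_mem fun g hg => (mem_cutEdges.1 (hF hg)).2
  by_cases hf : ∃ f ∈ cutEdges s t D W, f ≠ e
  · left
    obtain ⟨f, hfW, hfe⟩ := hf
    have hfx := hcut f hfW
    obtain ⟨o, hox, hof, hbo⟩ := exists_other_end hfx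
    have hoW : o ∈ W := by
      have h1 := (mem_cutEdges.1 hfW).2
      have h2 := (mem_cutEdges.1 hfx).2
      simp only [mem_singleton] at h2
      rcases hof with rfl | rfl
      · have h3 : t f = x := by tauto
        rw [h3] at h1; tauto
      · have h3 : s f = x := by tauto
        rw [h3] at h1; tauto
    obtain ⟨A, hA, hbA⟩ := mem_reach.1 hoW
    have hF : ({e, f} : Finset E) ⊆ cutEdges s t D {x} := by
      intro g hg
      simp only [mem_insert, mem_singleton] at hg
      rcases hg with rfl | rfl <;> assumption
    refine ⟨A ∪ {e, f}, hsub A hA _ hF, f, hfe, hcutU A hA _ hF, ?_⟩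
    have h1 : ({e, f} : Finset E) = {e} ∪ {f} := rfl
    rw [boundary_disjUnion (hdisj A hA _ hF), h1,
      boundary_disjUnion (by simpa using hfe.symm), hbv, hbo, hbA, single_add_cancel,
      add_self_zmodTwo]
  · right
    have hvW : v ∈ W := self_mem_reach _ _
    have heW : cutEdges s t D W = {e} := by
      push Not at hf
      refine subset_antisymm (fun g hg => mem_singleton.2 (hf g hg)) ?_
      rw [singleton_subset_iff, mem_cutEdges]
      have h2 := mem_cutEdges.1 he
      simp only [mem_singleton] at h2
      refine ⟨h2.1, ?_⟩
      rcases hve with rfl | rfl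
      · have h3 : t e = x := by tauto
        rw [h3]; tauto
      · have h3 : s e = x := by tauto
        rw [h3]; tauto
    have h1 := sum_boundary (s := s) (t := t) D W
    rw [heW, card_singleton, Nat.cast_one] at h1
    obtain ⟨z, hzW, hz⟩ := exists_ne_zero_of_sum_ne_zero (h1.trans_ne one_ne_zero)
    obtain ⟨A, hA, hbA⟩ := mem_reach.1 hzW
    have hF : ({e} : Finset E) ⊆ cutEdges s t D {x} := by simpa using he
    refine ⟨A ∪ {e}, hsub A hA _ hF, z, hcutU A hA _ hF, ?_, hz, ?_⟩
    · rintro rfl; exact hxW hzW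
    · rw [boundary_disjUnion (hdisj A hA _ hF), hbv, hbA, add_comm (Pi.single x 1),
        add_comm, add_comm (Pi.single v 1) (Pi.single x 1), add_comm (Pi.single x 1)]
      exact single_add_cancel _ _ _

end Multigraph

/-! ### Signed lengths and the vertex whose star can be subtracted -/

section SignedLength

variable {V E : Type*} [DecidableEq V] [DecidableEq E] {s t : E → V}

/-- The length of `A` for the weights `d` with the sign changed on `J`. -/
def signedLength (J : Finset E) (d : E → ℤ) (A : Finset E) : ℤ :=
  ∑ e ∈ A, if e ∈ J then - d e else d e

/-- The signed length of `A` is the change of weight when `J` is replaced by its symmetric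
difference with `A`. So `J` is cheapest for its boundary exactly when no cycle has negative length.
-/
lemma sum_symmDiff_eq (J A : Finset E) (d : E → ℤ) :
    ∑ e ∈ symmDiff J A, d e = ∑ e ∈ J, d e + signedLength J d A := by
  have h1 : symmDiff J A = (J \ A) ∪ (A \ J) := rfl
  have h2 : Disjoint (J \ A) (A \ J) := by
    rw [disjoint_left]; intro e; simp only [mem_sdiff]; tauto
  have h3 := sum_inter_add_sum_sdiff J A d
  have h4 := sum_inter_add_sum_sdiff A J fun e => if e ∈ J then - d e else d e
  have h5 : ∑ e ∈ A \ J, (if e ∈ J then - d e else d e) = ∑ e ∈ A \ J, d e :=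
    sum_congr rfl fun e he => by simp [(mem_sdiff.1 he).2]
  have h6 : ∑ e ∈ A ∩ J, (if e ∈ J then - d e else d e) = - ∑ e ∈ J ∩ A, d e := by
    rw [inter_comm, ← sum_neg_distrib]
    exact sum_congr rfl fun e he => by simp [(mem_inter.1 he).1]
  rw [h1, sum_union h2, signedLength]
  linarith

lemma signedLength_sdiff {J A B : Finset E} (d : E → ℤ) (h : B ⊆ A) :
    signedLength J d (A \ B) = signedLength J d A - signedLength J d B := by
  have := sum_sdiff (f := fun e => if e ∈ J then - d e else d e) h
  unfold signedLength; linarith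

lemma signedLength_union {J A B : Finset E} (d : E → ℤ) (h : Disjoint A B) :
    signedLength J d (A ∪ B) = signedLength J d A + signedLength J d B :=
  sum_union h

lemma signedLength_insert {J A : Finset E} (d : E → ℤ) {e : E} (h : e ∉ A) :
    signedLength J d (insert e A) = (if e ∈ J then - d e else d e) + signedLength J d A :=
  sum_insert h

lemma signedLength_singleton {J : Finset E} (d : E → ℤ) (e : E) :
    signedLength J d {e} = if e ∈ J then - d e else d e :=
  sum_singleton _ _

/-- Weights that are congruent modulo two to the differences of a potential are even on cycles. -/
lemma even_signedLength [Fintype V] {J A : Finset E} {c : E → ℕ} {p : V → ZMod 2}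
    (hp : ∀ e, (c e : ZMod 2) = p (s e) + p (t e)) (hA : boundary s t A = 0) :
    Even (signedLength J (fun e => (c e : ℤ)) A) := by
  rw [← ZMod.intCast_eq_zero_iff_even, signedLength, Int.cast_sum]
  have h1 := sum_boundary_mul (s := s) (t := t) A p
  rw [hA] at h1
  simp only [Pi.zero_apply, mul_zero, sum_const_zero] at h1
  rw [h1]
  refine sum_congr rfl fun e _ => ?_
  rw [← hp]
  split_ifs <;> simp

/-- Some path is of minimal signed length and, subject to that, of minimal weight. -/
lemma exists_minimal_path [Fintype E] (J : Finset E) (c : E → ℕ) {e : E} (heJ : e ∈ J)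
    (hce : 0 < c e) :
    ∃ P x y, boundary s t P = Pi.single x 1 + Pi.single y 1 ∧
      signedLength J (fun e => (c e : ℤ)) P < 0 ∧
      ∀ Q a b, boundary s t Q = Pi.single a 1 + Pi.single b 1 →
        signedLength J (fun e => (c e : ℤ)) P ≤ signedLength J (fun e => (c e : ℤ)) Q ∧
        (signedLength J (fun e => (c e : ℤ)) Q = signedLength J (fun e => (c e : ℤ)) P →
          ∑ e ∈ P, c e ≤ ∑ e ∈ Q, c e) := by
  classical
  set l := signedLength J (fun e => (c e : ℤ)) with hl
  -- The ends may coincide, so cycles compete too; in the application they are ruled out by their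
  -- nonnegative length.
  set S : Finset (Finset E) :=
    {P | ∃ x y, boundary s t P = Pi.single x 1 + Pi.single y 1} with hS
  have memS : ∀ P, P ∈ S ↔ ∃ x y, boundary s t P = Pi.single x 1 + Pi.single y 1 := by
    intro P; simp [hS]
  have heS : {e} ∈ S := (memS _).2 ⟨s e, t e, boundary_singleton e⟩
  obtain ⟨P₀, hP₀, hmin₀⟩ := exists_min_image S l ⟨_, heS⟩
  obtain ⟨P, hP, hmin⟩ := exists_min_image ({P ∈ S | l P = l P₀} : Finset (Finset E))
    (fun P => ∑ e ∈ P, c e) ⟨P₀, by simp [hP₀]⟩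
  rw [mem_filter] at hP
  obtain ⟨x, y, hxy⟩ := (memS P).1 hP.1
  refine ⟨P, x, y, hxy, ?_, fun Q a b hQ => ?_⟩
  · rw [hP.2]
    refine (hmin₀ _ heS).trans_lt ?_
    rw [hl, signedLength_singleton, if_pos heJ]
    simpa using hce
  · have hQS : Q ∈ S := (memS Q).2 ⟨a, b, hQ⟩
    refine ⟨hP.2 ▸ hmin₀ Q hQS, fun h => hmin Q ?_⟩
    rw [mem_filter]
    exact ⟨hQS, h.trans hP.2⟩

/-- If `J` has minimal weight for its boundary, then some vertex `x` is incident with exactly one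
edge of `J`, and lowering the weights at `x` by one keeps `J` minimal. -/
theorem exists_reducible_vertex [Fintype V] [Fintype E] {J : Finset E} {c : E → ℕ}
    {p : V → ZMod 2} (hp : ∀ e, (c e : ZMod 2) = p (s e) + p (t e))
    (hpos : ∀ e, s e ≠ t e → 0 < c e)
    (hmin : ∀ C, boundary s t C = 0 → 0 ≤ signedLength J (fun e => (c e : ℤ)) C)
    (hJ : 0 < ∑ e ∈ J, c e) :
    ∃ x, #(cutEdges s t J {x}) = 1 ∧ ∀ C, boundary s t C = 0 →
      signedLength J (fun _ => 1) (cutEdges s t C {x}) ≤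
        signedLength J (fun e => (c e : ℤ)) C := by
  classical
  set l := signedLength J (fun e => (c e : ℤ)) with hl
  obtain ⟨e₀, he₀J, hce₀⟩ : ∃ e ∈ J, 0 < c e := by
    by_contra! h
    exact hJ.ne' (sum_eq_zero fun e he => by simpa using h e he)
  obtain ⟨P, x, y, hP, hPneg, hPmin⟩ := exists_minimal_path (s := s) (t := t) J c he₀J hce₀
  rw [← hl] at hPneg hPmin
  have hxy : x ≠ y := by
    rintro rfl
    rw [add_self_zmodTwo] at hP
    exact absurd (hmin P hP) (not_le.2 hPneg)
  have hcut : ∀ {A : Finset E} {e}, e ∈ cutEdges s t A {x} → 0 < c e := by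
    intro A e he
    refine hpos e fun h => ?_
    have := (mem_cutEdges.1 he).2
    rw [h] at this; exact this Iff.rfl
  have hloops : ∀ A : Finset E, ∑ e ∈ A, c e = 0 → boundary s t A = 0 := by
    intro A hA
    refine boundary_eq_zero_of_loops fun e he => ?_
    by_contra h
    exact (hpos e h).ne' (sum_eq_zero_iff.1 hA e he)
  have hsum : ∀ {A B : Finset E}, B ⊆ A →
      ∑ e ∈ A \ B, c e + ∑ e ∈ B, c e = ∑ e ∈ A, c e := fun h => sum_sdiff h
  -- A piece `A` of `P` from `x` has negative length: `P \ A` is again a candidate, so `l A ≤ 0`,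
  -- and equality would make `A` weightless by the second minimality, hence a set of loops.
  have hsub : ∀ A ⊆ P, ∀ z, z ≠ x → boundary s t A = Pi.single x 1 + Pi.single z 1 → l A < 0 := by
    intro A hA z hz hb
    have hb' : boundary s t (P \ A) = Pi.single y 1 + Pi.single z 1 := by
      rw [boundary_sdiff hA, hP, hb, single_add_cancel]
    obtain ⟨h1, h2⟩ := hPmin _ _ _ hb'
    rw [hl, signedLength_sdiff _ hA, ← hl] at h1 h2
    by_contra! h3
    have h4 := h2 (by linarith)
    have h5 := hsum hA
    have h6 := hloops A (by omega)
    rw [hb] at h6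
    exact hz (single_add_single_eq_zero h6).symm
  have hPJ : ∀ e ∈ cutEdges s t P {x}, e ∈ J := by
    intro e he
    by_contra heJ
    obtain ⟨o, hox, -, hbo⟩ := exists_other_end he
    have h1 := hsub {e} (by simpa using (mem_cutEdges.1 he).1) o hox hbo
    rw [hl, signedLength_singleton, if_neg heJ] at h1
    have := hcut he
    omega
  -- An edge of `J` at `x` outside `P` could be appended to `P`, which would shorten it.
  have hJP : ∀ e ∈ cutEdges s t J {x}, e ∈ P := by
    intro e he
    by_contra heP
    obtain ⟨o, hox, -, hbo⟩ := exists_other_end he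
    have h1 := (hPmin (P ∪ {e}) y o (by
      rw [boundary_disjUnion (by simpa using heP), hP, hbo, single_add_cancel])).1
    rw [hl, signedLength_union _ (by simpa using heP), signedLength_singleton,
      if_pos (mem_cutEdges.1 he).1] at h1
    have := hcut he
    omega
  -- A cycle in `P` through `x` could be dropped, against the minimality of the weight. A path in
  -- `P` from `x` ends at `y` and is all of `P` up to weightless edges, which are not at `x`.
  have hone : ∃ e, cutEdges s t P {x} = {e} := by
    have h1 : (cutEdges s t P {x}).Nonempty := by
      by_contra h
      rw [not_nonempty_iff_eq_empty] at h
      have h2 := sum_boundary (s := s) (t := t) P {x}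
      rw [h, hP] at h2
      simp [Pi.single_apply, hxy] at h2
    obtain ⟨e, he⟩ := h1
    rcases exists_cycle_or_path he with ⟨B, hB, f, hfe, hBx, hbB⟩ | ⟨B, hB, z, hBx, hzx, hz, hbB⟩
    · exfalso
      have h1 := hPmin (P \ B) x y (by rw [boundary_sdiff hB, hbB, add_zero, hP])
      rw [hl, signedLength_sdiff _ hB, ← hl] at h1
      have h2 := hmin B hbB
      have h3 := h1.2 (by linarith [h1.1])
      have h4 := hsum hB
      have heB : e ∈ cutEdges s t B {x} := by rw [hBx]; simp
      have h5 := sum_eq_zero_iff.1 (show ∑ e ∈ B, c e = 0 by omega) e (mem_cutEdges.1 heB).1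
      exact (hcut he).ne' h5
    · have hzy : z = y := by
        by_contra hzy
        rw [hP] at hz
        simp [hzx, hzy] at hz
      subst hzy
      refine ⟨e, ?_⟩
      have h1 := hPmin B x z hbB
      have h2 := hmin (P \ B) (by rw [boundary_sdiff hB, hbB, hP, add_self_zmodTwo])
      rw [hl, signedLength_sdiff _ hB, ← hl] at h2
      have h3 := h1.2 (by linarith [h1.1])
      have h4 := hsum hB
      rw [← hBx]
      ext g
      simp only [mem_cutEdges]
      refine ⟨fun hg => ⟨?_, hg.2⟩, fun hg => ⟨hB hg.1, hg.2⟩⟩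
      by_contra hgB
      have h5 := sum_eq_zero_iff.1 (show ∑ e ∈ P \ B, c e = 0 by omega) g
        (mem_sdiff.2 ⟨hg.1, hgB⟩)
      exact (hcut (mem_cutEdges.2 hg)).ne' h5
  obtain ⟨e, he⟩ := hone
  have heP : e ∈ cutEdges s t P {x} := by rw [he]; simp
  have heJ := hPJ e heP
  have hJx : cutEdges s t J {x} = {e} := by
    refine subset_antisymm (fun g hg => ?_) ?_
    · rw [← he, mem_cutEdges]
      exact ⟨hJP g hg, (mem_cutEdges.1 hg).2⟩
    · rw [singleton_subset_iff, mem_cutEdges]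
      exact ⟨heJ, (mem_cutEdges.1 heP).2⟩
  refine ⟨x, by rw [hJx, card_singleton], fun C => ?_⟩
  induction C using Finset.strongInduction with
  | H C ih =>
  intro hC
  -- Both sides are additive over disjoint cycles, so `C` may be taken to contain no smaller
  -- nonempty cycle; it then has no edge or exactly two edges at `x`.
  by_cases hsplit : ∃ B ⊆ C, B ≠ C ∧ B.Nonempty ∧ boundary s t B = 0
  · obtain ⟨B, hB, hBC, hBne, hbB⟩ := hsplit
    have hb' : boundary s t (C \ B) = 0 := by rw [boundary_sdiff hB, hbB, hC, add_zero]
    have h1 := ih B (hB.ssubset_of_ne hBC) hbB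
    have h2 := ih (C \ B) (sdiff_ssubset hB hBne) hb'
    have hBB : cutEdges s t B {x} ⊆ cutEdges s t C {x} := filter_subset_filter _ hB
    have h3 : cutEdges s t (C \ B) {x} = cutEdges s t C {x} \ cutEdges s t B {x} := by
      ext g; simp only [mem_cutEdges, mem_sdiff]; tauto
    rw [h3, signedLength_sdiff _ hBB, hl, signedLength_sdiff _ hB] at h2
    linarith
  push Not at hsplit
  have hcirc : ∀ B ⊆ C, B.Nonempty → boundary s t B = 0 → B = C := fun B hB hne hb => by
    by_contra h
    exact hsplit B hB h hne hb
  rcases (cutEdges s t C {x}).eq_empty_or_nonempty with h0 | ⟨f₁, hf₁⟩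
  · rw [h0]
    exact hmin C hC
  obtain ⟨f₂, hne, hCx⟩ : ∃ f₂, f₂ ≠ f₁ ∧ cutEdges s t C {x} = {f₁, f₂} := by
    rcases exists_cycle_or_path hf₁ with ⟨B, hB, f, hfe, hBx, hbB⟩ | ⟨B, hB, z, hBx, hzx, hz, hbB⟩
    · have hf₁B : f₁ ∈ cutEdges s t B {x} := by rw [hBx]; simp
      have := hcirc B hB ⟨f₁, (mem_cutEdges.1 hf₁B).1⟩ hbB
      exact ⟨f, hfe, this ▸ hBx⟩
    · rw [hC] at hz
      exact absurd rfl hz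
  have hf₂ : f₂ ∈ cutEdges s t C {x} := by rw [hCx]; simp
  have hl1 : signedLength J (fun _ => 1) (cutEdges s t C {x}) =
      (if f₁ ∈ J then -1 else 1) + (if f₂ ∈ J then -1 else 1) := by
    rw [hCx, signedLength_insert _ (by simpa using hne.symm), signedLength_singleton]
  have hl0 := hmin C hC
  rw [hl1]
  by_cases hJ1 : f₁ ∈ J
  · rw [if_pos hJ1]; split_ifs <;> omega
  by_cases hJ2 : f₂ ∈ J
  · rw [if_pos hJ2]; split_ifs; omega
  rw [if_neg hJ1, if_neg hJ2]
  -- With both edges of `C` at `x` outside `J`, length at least 2 is needed. By parity only length 0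
  -- must be excluded.
  have heven : Even (l C) := even_signedLength hp hC
  suffices l C ≠ 0 by
    obtain ⟨k, hk⟩ := heven
    change 0 ≤ l C at hl0
    omega
  intro hlC
  have hconn : ∀ g ∈ C, s g ∈ reach s t C x ∧ t g ∈ reach s t C x := by
    set C' := C.filter (fun g => s g ∈ reach s t C x) with hC'
    have hC'C : C' ⊆ C := filter_subset _ _
    have hb' : boundary s t C' = 0 := by
      funext v
      by_cases hv : v ∈ reach s t C x
      · rw [← hC]
        simp only [boundary, Finset.sum_apply]
        refine sum_subset hC'C fun g hg hg' => ?_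
        have h1 : s g ∉ reach s t C x := fun h => hg' (mem_filter.2 ⟨hg, h⟩)
        have h2 : t g ∉ reach s t C x := fun h => h1 ((reach_closed hg).2 h)
        have h3 : v ≠ s g := by rintro rfl; exact h1 hv
        have h4 : v ≠ t g := by rintro rfl; exact h2 hv
        simp [h3, h4]
      · simp only [boundary, Finset.sum_apply]
        refine sum_eq_zero fun g hg => ?_
        have h1 := mem_filter.1 hg
        have h2 := (reach_closed h1.1).1 h1.2
        have h3 : v ≠ s g := by rintro rfl; exact hv h1.2
        have h4 : v ≠ t g := by rintro rfl; exact hv h2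
        simp [h3, h4]
    have hf₁' := mem_cutEdges.1 hf₁
    have hne' : C'.Nonempty := by
      refine ⟨f₁, mem_filter.2 ⟨hf₁'.1, ?_⟩⟩
      have hx := self_mem_reach (s := s) (t := t) C x
      by_cases h1 : s f₁ = x
      · rwa [h1]
      · have h2 : t f₁ = x := by
          have := hf₁'.2
          simp only [mem_singleton] at this
          tauto
        rw [reach_closed hf₁'.1, h2]; exact hx
    have hCC := hcirc C' hC'C hne' hb'
    intro g hg
    have h1 : s g ∈ reach s t C x := (mem_filter.1 (hCC.symm ▸ hg : g ∈ C')).2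
    exact ⟨h1, (reach_closed hg).1 h1⟩
  -- `W` is what `P` reaches from `x` while avoiding `C`. If it met `C` at some `z ≠ x`, the two
  -- arcs of `C` from `x` to `z`, of total length 0, would each close a cycle with a path of
  -- negative length, and one of these cycles would be negative.
  set W := reach s t (P \ C) x with hW
  have hWC : ∀ z ∈ W, z ≠ x → z ∉ reach s t C x := by
    intro z hzW hzx hzC
    obtain ⟨A, hA, hbA⟩ := mem_reach.1 hzW
    obtain ⟨B, hB, hbB⟩ := mem_reach.1 hzC
    have hAneg := hsub A (hA.trans sdiff_subset) z hzx hbA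
    have hAC : Disjoint A C := disjoint_of_subset_left hA sdiff_disjoint
    have hAB : Disjoint A B := disjoint_of_subset_right hB hAC
    have hAB' : Disjoint A (C \ B) := disjoint_of_subset_right sdiff_subset hAC
    have h1 := hmin (A ∪ B) (by rw [boundary_disjUnion hAB, hbA, hbB, add_self_zmodTwo])
    have h2 := hmin (A ∪ (C \ B)) (by
      rw [boundary_disjUnion hAB', boundary_sdiff hB, hbA, hbB, hC, zero_add, add_self_zmodTwo])
    rw [hl, signedLength_union _ hAB] at h1
    rw [hl, signedLength_union _ hAB', signedLength_sdiff _ hB] at h2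
    linarith
  -- An edge of `P` leaving `W` lies in `C`, so its end in `W` is `x`. It is then in `J`, unlike
  -- `f₁` and `f₂`.
  have hPW : cutEdges s t P W = ∅ := by
    rw [eq_empty_iff_forall_notMem]
    intro g hg
    have hg' := mem_cutEdges.1 hg
    have hgC : g ∈ C := by
      by_contra hgC
      exact hg'.2 (reach_closed (mem_sdiff.2 ⟨hg'.1, hgC⟩))
    have hs : s g ∈ W → s g = x := fun h => by
      by_contra h2; exact hWC _ h h2 (hconn g hgC).1
    have ht : t g ∈ W → t g = x := fun h => by
      by_contra h2; exact hWC _ h h2 (hconn g hgC).2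
    have hxW : x ∈ W := self_mem_reach _ _
    have hgx : ¬ (s g ∈ ({x} : Finset V) ↔ t g ∈ ({x} : Finset V)) := by
      simp only [mem_singleton]
      intro h
      have hs' : s g = x → s g ∈ W := fun h => h ▸ hxW
      have ht' : t g = x → t g ∈ W := fun h => h ▸ hxW
      tauto
    have hgJ := hPJ g (mem_cutEdges.2 ⟨hg'.1, hgx⟩)
    have hgf : g ∈ cutEdges s t C {x} := mem_cutEdges.2 ⟨hgC, hgx⟩
    rw [hCx, mem_insert, mem_singleton] at hgf
    rcases hgf with rfl | rfl
    · exact hJ1 hgJ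
    · exact hJ2 hgJ
  have hyW : y ∈ W := by
    by_contra hyW
    have h1 := sum_boundary (s := s) (t := t) P W
    rw [hPW, hP] at h1
    have hxW : x ∈ W := self_mem_reach _ _
    simp [sum_add_distrib, Pi.single_apply, hyW, hxW] at h1
  -- `A` joins `y` to `x` off `C` and is no longer than `P`. Continuing around `C` up to `f₂` adds
  -- `0 - c f₂ < 0`, against the minimality of `P`.
  obtain ⟨A, hA, hbA⟩ := mem_reach.1 hyW
  have hAP : A ⊆ P := hA.trans sdiff_subset
  have h1 := hmin (P \ A) (by rw [boundary_sdiff hAP, hbA, hP, add_self_zmodTwo])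
  rw [hl, signedLength_sdiff _ hAP, ← hl] at h1
  obtain ⟨o, hox, -, hbo⟩ := exists_other_end hf₂
  have hf₂C : {f₂} ⊆ C := by simpa using (mem_cutEdges.1 hf₂).1
  have hAC : Disjoint A (C \ {f₂}) :=
    disjoint_of_subset_right sdiff_subset (disjoint_of_subset_left hA sdiff_disjoint)
  have h2 := (hPmin (A ∪ (C \ {f₂})) y o (by
    rw [boundary_disjUnion hAC, boundary_sdiff hf₂C, hbA, hbo, hC, zero_add,
      single_add_cancel])).1
  rw [hl, signedLength_union _ hAC, signedLength_sdiff _ hf₂C, signedLength_singleton, if_neg hJ2,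
    ← hl] at h2
  have := hcut hf₂
  omega

end SignedLength

/-! ### Contraction and the lower bound from `T`-odd cuts -/

section CutBound

variable {V E : Type*} [DecidableEq V] [DecidableEq E] [Fintype V] [Fintype E]

/-- The image of a vertex labelling under a map of the vertex set. -/
def pushForward (g : V → V) (f : V → ZMod 2) : V → ZMod 2 :=
  ∑ u, Pi.single (g u) (f u)

lemma pushForward_add (g : V → V) (f h : V → ZMod 2) :
    pushForward g (f + h) = pushForward g f + pushForward g h := by
  simp [pushForward, Pi.single_add, sum_add_distrib]

lemma pushForward_single (g : V → V) (a : V) :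
    pushForward g (Pi.single a 1) = Pi.single (g a) 1 := by
  unfold pushForward
  rw [sum_eq_single a (fun b _ hb => by simp [hb]) (by simp)]
  simp

/-- Contraction only changes the end maps: the edge set stays the same and contracted edges survive
as loops. -/
lemma pushForward_boundary (g : V → V) (s t : E → V) (A : Finset E) :
    pushForward g (boundary s t A) = boundary (g ∘ s) (g ∘ t) A := by
  induction A using Finset.induction_on with
  | empty => simp [boundary_empty, pushForward]
  | insert e A he ih =>
    rw [insert_eq, boundary_disjUnion (by simpa using he), boundary_disjUnion (by simpa using he),
      pushForward_add, ih, boundary_singleton, boundary_singleton, pushForward_add,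
      pushForward_single, pushForward_single]
    rfl

lemma sum_pushForward (g : V → V) (f : V → ZMod 2) (U : Finset V) :
    ∑ v ∈ U, pushForward g f v = ∑ u with g u ∈ U, f u := by
  simp only [pushForward, Finset.sum_apply]
  rw [sum_comm, sum_filter]
  refine sum_congr rfl fun u _ => ?_
  simp [Pi.single_apply]

/-- The labellings that vanish when `b` is identified with `a`. -/
lemma pushForward_eq_zero {a b : V} (hab : a ≠ b) {f : V → ZMod 2}
    (h : pushForward (fun v => if v = b then a else v) f = 0) :
    f = 0 ∨ f = Pi.single a 1 + Pi.single b 1 := by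
  have h1 : ∀ v, ∑ u with (if u = b then a else u) = v, f u = 0 := by
    intro v
    have := sum_pushForward (fun v => if v = b then a else v) f {v}
    rw [h] at this
    simpa using this.symm
  have h2 : ∀ v, v ≠ a → v ≠ b → f v = 0 := by
    intro v hva hvb
    rw [← h1 v]
    symm
    apply sum_eq_single_of_mem
    · simp [hvb]
    · intro u hu huv
      rw [mem_filter] at hu
      have := hu.2
      split_ifs at this
      · exact absurd this.symm hva
      · exact absurd this huv
  have h3 : f a + f b = 0 := by
    rw [← h1 a, ← sum_pair hab]
    refine sum_congr ?_ fun _ _ => rfl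
    ext u
    by_cases hu : u = b <;> simp [hu]
  have h4 : f a = f b := CharTwo.add_eq_zero.1 h3
  have h5 : ∀ z : ZMod 2, z = 0 ∨ z = 1 := by decide
  rcases h5 (f a) with h6 | h6
  · left
    funext v
    by_cases hva : v = a
    · rw [hva, h6]; rfl
    by_cases hvb : v = b
    · rw [hvb, ← h4, h6]; rfl
    exact h2 v hva hvb
  · right
    funext v
    by_cases hva : v = a
    · subst hva; simp [h6, hab]
    by_cases hvb : v = b
    · subst hvb; simp [← h4, h6, hva]
    simp [h2 v hva hvb, hva, hvb]

/-- Let `c` be even on cycles. If every edge set with boundary `T` has `c`-weight at least `N`,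
and every `T`-odd cut has `w`-weight at least `κ`, then the product of `c` and `w` is at
least `N * κ`. -/
theorem mul_le_sum_of_even {w : E → ℝ} (hw : ∀ e, 0 ≤ w e) {κ : ℝ} (m : ℕ) :
    ∀ (N : ℕ) (s t : E → V) (T : V → ZMod 2) (c : E → ℕ) (p : V → ZMod 2),
      N + #{e | s e ≠ t e} ≤ m → (∀ e, (c e : ZMod 2) = p (s e) + p (t e)) →
      (∃ J, boundary s t J = T) → (∀ J, boundary s t J = T → N ≤ ∑ e ∈ J, c e) →
      (∀ U, ∑ v ∈ U, T v = 1 → κ ≤ ∑ e ∈ cutEdges s t univ U, w e) →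
      N * κ ≤ ∑ e, w e * c e := by
  -- `m` bounds `N` plus the number of non-loops: contraction lowers the second, subtraction of a
  -- star the first.
  induction m with
  | zero =>
    intro N s t T c p hm _ _ _ _
    have : N = 0 := by omega
    subst this
    simp only [Nat.cast_zero, zero_mul]
    exact sum_nonneg fun e _ => mul_nonneg (hw e) (Nat.cast_nonneg _)
  | succ m ih =>
    intro N s t T c p hm hp hex hN hcut
    rcases N.eq_zero_or_pos with rfl | hNpos
    · simp only [Nat.cast_zero, zero_mul]
      exact sum_nonneg fun e _ => mul_nonneg (hw e) (Nat.cast_nonneg _)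
    by_cases hzero : ∃ e, s e ≠ t e ∧ c e = 0
    -- Contract `e₀`. A set with the right boundary afterwards has boundary `T` already, or does
    -- after toggling `e₀`, which costs nothing.
    · obtain ⟨e₀, hne, hc0⟩ := hzero
      set g : V → V := fun v => if v = t e₀ then s e₀ else v with hg
      have hpe : p (s e₀) = p (t e₀) := by
        have := hp e₀
        rw [hc0, Nat.cast_zero] at this
        exact CharTwo.add_eq_zero.1 this.symm
      have hpg : ∀ v, p (g v) = p v := by
        intro v
        simp only [hg]
        split_ifs with h
        · rw [h, hpe]
        · rfl
      refine ih N (g ∘ s) (g ∘ t) (pushForward g T) c p ?_ ?_ ?_ ?_ ?_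
      · have : #{e | (g ∘ s) e ≠ (g ∘ t) e} < #{e | s e ≠ t e} := by
          refine card_lt_card ⟨?_, ?_⟩
          · intro e
            simp only [mem_filter, mem_univ, true_and, Function.comp]
            exact fun h1 h2 => h1 (by rw [h2])
          · intro h
            have := h (mem_filter.2 ⟨mem_univ e₀, hne⟩)
            simp [hg] at this
        omega
      · intro e
        rw [hp e, Function.comp, Function.comp, hpg, hpg]
      · obtain ⟨J, hJ⟩ := hex
        exact ⟨J, by rw [← pushForward_boundary, hJ]⟩
      · intro J hJ
        rw [← pushForward_boundary] at hJ
        have h1 : pushForward g (boundary s t J + T) = 0 := by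
          rw [pushForward_add, hJ, add_self_zmodTwo]
        rcases pushForward_eq_zero hne h1 with h2 | h2
        · refine hN J ?_
          rw [← add_zero T, ← h2, add_comm (boundary s t J), ← add_assoc, add_self_zmodTwo,
            zero_add]
        · have h3 : boundary s t (symmDiff J {e₀}) = T := by
            rw [boundary_symmDiff, boundary_singleton, ← h2, ← add_assoc, add_self_zmodTwo,
              zero_add]
          refine (hN _ h3).trans ?_
          calc ∑ e ∈ symmDiff J {e₀}, c e ≤ ∑ e ∈ insert e₀ J, c e := by
                refine sum_le_sum_of_subset fun e he => ?_
                simp only [mem_symmDiff, mem_singleton, mem_insert] at he ⊢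
                tauto
            _ ≤ ∑ e ∈ J, c e := by
                rw [sum_insert_of_eq_zero_if_notMem]
                exact fun _ => hc0
      · intro U hU
        rw [sum_pushForward] at hU
        refine (hcut _ hU).trans_eq (sum_congr ?_ fun _ _ => rfl)
        ext e
        simp [mem_cutEdges]
    · push Not at hzero
      have hpos : ∀ e, s e ≠ t e → 0 < c e := fun e he => Nat.pos_of_ne_zero (hzero e he)
      classical
      obtain ⟨J, hJ, hJmin⟩ := exists_min_image
        (univ.filter fun J : Finset E => boundary s t J = T) (fun J => ∑ e ∈ J, c e)
        (by obtain ⟨J, hJ⟩ := hex; exact ⟨J, by simpa using hJ⟩)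
      simp only [mem_filter, mem_univ, true_and] at hJ hJmin
      have hNJ := hN J hJ
      have hmin : ∀ C, boundary s t C = 0 →
          0 ≤ signedLength J (fun e => (c e : ℤ)) C := by
        intro C hC
        have h1 := hJmin (symmDiff J C) (by rw [boundary_symmDiff, hJ, hC, add_zero])
        have h2 := sum_symmDiff_eq J C fun e => (c e : ℤ)
        have h3 : ((∑ e ∈ J, c e : ℕ) : ℤ) ≤ ((∑ e ∈ symmDiff J C, c e : ℕ) : ℤ) := by
          exact_mod_cast h1
        push_cast at h3
        linarith
      obtain ⟨x, hx1, hx2⟩ := exists_reducible_vertex hp hpos hmin (by omega)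
      -- Subtracting the star `q` of `x` lowers `∑ w c` by the weight of a `T`-odd cut, at least
      -- `κ`, and leaves every `T`-join with weight at least `N - 1`. Adding 1 to the potential at
      -- `x` accounts for the changed parities.
      set q : E → ℕ := fun e => if e ∈ cutEdges s t univ {x} then 1 else 0 with hq
      have hqc : ∀ e, q e ≤ c e := by
        intro e
        simp only [hq]
        split_ifs with h
        · refine hpos e fun h2 => ?_
          have := (mem_cutEdges.1 h).2
          rw [h2] at this
          exact this Iff.rfl
        · exact Nat.zero_le _
      have hTx : ∑ v ∈ {x}, T v = 1 := by
        rw [← hJ, sum_boundary, hx1, Nat.cast_one]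
      have hcutA : ∀ A, ∑ e ∈ A, q e = #(cutEdges s t A {x}) := by
        intro A
        rw [cutEdges, card_filter]
        refine sum_congr rfl fun e _ => ?_
        simp [hq, mem_cutEdges]
      have hrec := ih (N - 1) s t T (fun e => c e - q e) (p + Pi.single x 1) (by omega) ?_ hex ?_
        hcut
      · have h1 : ∑ e, w e * (q e : ℝ) = ∑ e ∈ cutEdges s t univ {x}, w e := by
          rw [cutEdges, sum_filter]
          refine sum_congr rfl fun e _ => ?_
          simp [hq, mem_cutEdges]
        have h2 := hcut {x} hTx
        have h3 : ∑ e, w e * (c e : ℝ) =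
            ∑ e, w e * ((c e - q e : ℕ) : ℝ) + ∑ e, w e * (q e : ℝ) := by
          rw [← sum_add_distrib]
          refine sum_congr rfl fun e _ => ?_
          rw [Nat.cast_sub (hqc e)]; ring
        have h4 : ((N - 1 : ℕ) : ℝ) = N - 1 := by
          rw [Nat.cast_sub hNpos, Nat.cast_one]
        rw [h4] at hrec
        linarith
      · intro e
        have h1 : (q e : ZMod 2) =
            (Pi.single x 1 : V → ZMod 2) (s e) + (Pi.single x 1 : V → ZMod 2) (t e) := by
          have h2 : (1 : ZMod 2) + 1 = 0 := CharTwo.add_self_eq_zero 1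
          by_cases ha : s e = x <;> by_cases hb : t e = x <;>
            simp [hq, mem_cutEdges, ha, hb, h2]
        rw [Nat.cast_sub (hqc e), hp e, h1, CharTwo.sub_eq_add]
        simp only [Pi.add_apply]
        ring
      · intro J' hJ'
        have hC : boundary s t (symmDiff J J') = 0 := by
          rw [boundary_symmDiff, hJ, hJ', add_self_zmodTwo]
        have h1 := hx2 _ hC
        have hJJ : symmDiff J (symmDiff J J') = J' := symmDiff_symmDiff_cancel_left J J'
        have h2 := sum_symmDiff_eq J (symmDiff J J') fun e => (c e : ℤ)
        have h3 := sum_symmDiff_eq J (symmDiff J J') fun e => (q e : ℤ)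
        rw [hJJ] at h2 h3
        have h4 : signedLength J (fun e => (q e : ℤ)) (symmDiff J J') =
            signedLength J (fun _ => 1) (cutEdges s t (symmDiff J J') {x}) := by
          unfold signedLength
          rw [cutEdges, sum_filter]
          refine sum_congr rfl fun e _ => ?_
          by_cases hce : ¬ (s e ∈ ({x} : Finset V) ↔ t e ∈ ({x} : Finset V))
          · simp only [hq, mem_cutEdges, mem_univ, true_and, if_pos hce, Nat.cast_one]
          · simp only [hq, mem_cutEdges, mem_univ, true_and, if_neg hce, Nat.cast_zero, neg_zero,
              ite_self]
        have h5 : ∑ e ∈ J, (q e : ℤ) = 1 := by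
          rw [← Nat.cast_sum, hcutA, hx1, Nat.cast_one]
        have h6 : ∑ e ∈ J', (c e - q e) + ∑ e ∈ J', q e = ∑ e ∈ J', c e := by
          rw [← sum_add_distrib]
          exact sum_congr rfl fun e _ => Nat.sub_add_cancel (hqc e)
        zify at h6 hNJ ⊢
        rw [Nat.cast_sub hNpos]
        push_cast at h6 ⊢
        linarith

/-- If every edge set with boundary `T` has `y`-weight at least one, and every `T`-odd cut has
`w`-weight at least `κ`, then the product of `y` and `w` is at least `κ`. -/
theorem le_sum_mul_of_cuts {s t : E → V} {T : V → ZMod 2} {w y : E → ℝ} {κ : ℝ}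
    (hw : ∀ e, 0 ≤ w e) (hy : ∀ e, 0 ≤ y e) (hex : ∃ J, boundary s t J = T)
    (hJ : ∀ J, boundary s t J = T → 1 ≤ ∑ e ∈ J, y e)
    (hcut : ∀ U, ∑ v ∈ U, T v = 1 → κ ≤ ∑ e ∈ cutEdges s t univ U, w e) :
    κ ≤ ∑ e, w e * y e := by
  have key : ∀ n : ℕ, n * κ ≤ n * ∑ e, w e * y e + ∑ e, w e := by
    intro n
    -- Doubling makes the rounded weights even, so the zero potential serves. The rounding error `∑
    -- w` does not grow with `n`.
    have h1 := mul_le_sum_of_even hw (κ := κ) _ (2 * n) s t T (fun e => 2 * ⌈n * y e⌉₊) 0 le_rfl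
      (fun e => by
        have : (2 : ZMod 2) = 0 := by decide
        simp [this]) hex (fun J hb => ?_) hcut
    · have h2 : ∑ e, w e * ((2 * ⌈n * y e⌉₊ : ℕ) : ℝ) ≤ ∑ e, w e * (2 * (n * y e + 1)) := by
        refine sum_le_sum fun e _ => mul_le_mul_of_nonneg_left ?_ (hw e)
        push_cast
        have := (Nat.ceil_lt_add_one (mul_nonneg n.cast_nonneg (hy e))).le
        linarith
      have h3 : ∑ e, w e * (2 * (n * y e + 1)) = 2 * (n * ∑ e, w e * y e + ∑ e, w e) := by
        rw [mul_sum, ← sum_add_distrib, mul_sum]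
        exact sum_congr rfl fun e _ => by ring
      push_cast at h1 h2
      linarith
    · rw [← mul_sum]
      refine Nat.mul_le_mul_left 2 ?_
      have h2 : (n : ℝ) ≤ ((∑ e ∈ J, ⌈n * y e⌉₊ : ℕ) : ℝ) := by
        push_cast
        calc (n : ℝ) ≤ n * ∑ e ∈ J, y e := le_mul_of_one_le_right n.cast_nonneg (hJ J hb)
          _ = ∑ e ∈ J, n * y e := mul_sum ..
          _ ≤ _ := sum_le_sum fun e _ => Nat.le_ceil _
      exact_mod_cast h2
  by_contra! h
  obtain ⟨n, hn⟩ := exists_nat_gt ((∑ e, w e) / (κ - ∑ e, w e * y e))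
  rw [div_lt_iff₀ (by linarith)] at hn
  have := key n
  linarith

end CutBound

lemma IsRelabelling.isIdeal {V W : Type*} [Fintype V] [Fintype W] {C : Set (Finset V)}
    {D : Set (Finset W)} (h : IsRelabelling C D) (hC : IsIdeal C) : IsIdeal D := by
  obtain ⟨f, rfl⟩ := h
  intro w
  obtain ⟨x, ⟨hx0, hx1⟩, hxint, hxopt⟩ := hC (w ∘ f)
  refine ⟨x ∘ f.symm, ⟨fun v => hx0 _, ?_⟩, fun v => hxint _, fun y hy => ?_⟩
  · rintro _ ⟨A, hA, rfl⟩
    simpa using hx1 A hA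
  · have h1 := hxopt (y ∘ f) ⟨fun v => hy.1 _, fun A hA => by
      simpa using hy.2 _ ⟨A, hA, rfl⟩⟩
    rw [← f.sum_comp, ← f.sum_comp fun v => (w v : ℝ) * y v]
    simpa using h1

/-! ### `T`-joins and cycles of simple graphs as boundary conditions; the Edmonds–Johnson theorem -/

section EdgeEnds

variable {V : Type*} {G : SimpleGraph V}

/-- The two ends of an edge, in an order chosen arbitrarily. -/
noncomputable def edgeEnd (e : G.edgeSet) (b : Bool) : V :=
  if b then e.1.out.1 else e.1.out.2

lemma mk_edgeEnd (e : G.edgeSet) : s(edgeEnd e true, edgeEnd e false) = e.1 :=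
  Quot.out_eq e.1

lemma adj_edgeEnd (e : G.edgeSet) : G.Adj (edgeEnd e true) (edgeEnd e false) := by
  rw [← SimpleGraph.mem_edgeSet, mk_edgeEnd]
  exact e.2

lemma mem_edge_iff {e : G.edgeSet} {v : V} :
    v ∈ e.1 ↔ v = edgeEnd e true ∨ v = edgeEnd e false := by
  rw [← mk_edgeEnd e, Sym2.mem_iff]

lemma edgeEnd_mem (e : G.edgeSet) (b : Bool) : edgeEnd e b ∈ e.1 := by
  rw [mem_edge_iff]
  cases b <;> simp

lemma edgeEnd_injective (e : G.edgeSet) : Function.Injective (edgeEnd e) := by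
  have := (adj_edgeEnd e).ne
  rintro (_ | _) (_ | _) h
  · rfl
  · exact absurd h.symm this
  · exact absurd h this
  · rfl

variable [DecidableEq V]

/-- The boundary modulo two of a set of edges of a simple graph. -/
noncomputable abbrev graphBoundary (J : Finset G.edgeSet) : V → ZMod 2 :=
  boundary (fun e => edgeEnd e true) (fun e => edgeEnd e false) J

lemma graphBoundary_symmDiff [DecidableEq G.edgeSet] (J K : Finset G.edgeSet) :
    graphBoundary (symmDiff J K) = graphBoundary J + graphBoundary K :=
  boundary_symmDiff J K

lemma cast_degreeIn (J : Finset G.edgeSet) (v : V) :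
    (degreeIn G J v : ZMod 2) = graphBoundary J v := by
  rw [degreeIn, card_filter, Nat.cast_sum, graphBoundary, boundary, Finset.sum_apply]
  refine sum_congr rfl fun e _ => ?_
  have h := (adj_edgeEnd e).ne
  simp only [mem_edge_iff, Pi.add_apply, Pi.single_apply]
  by_cases h1 : v = edgeEnd e true
  · have h2 : v ≠ edgeEnd e false := h1 ▸ h
    simp [h1, h]
  · simp [h1]

lemma isTJoin_iff {T : Finset V} {J : Finset G.edgeSet} :
    IsTJoin G T J ↔ graphBoundary J = fun v => if v ∈ T then 1 else 0 := by
  rw [IsTJoin, funext_iff]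
  refine forall_congr' fun v => ?_
  rw [← cast_degreeIn]
  split_ifs with h
  · rw [ZMod.natCast_eq_one_iff_odd]; simp [h]
  · rw [ZMod.natCast_eq_zero_iff_even, ← Nat.not_odd_iff_even]; simp [h]

lemma mem_cycleSpace_iff {p : G.edgeSet → Bool} [Fintype G.edgeSet] :
    p ∈ cycleSpace G ↔ graphBoundary ({e | p e} : Finset G.edgeSet) = 0 := by
  have key : ∀ J : Finset G.edgeSet, (∀ v, Even (degreeIn G J v)) ↔ graphBoundary J = 0 := by
    intro J
    rw [funext_iff]
    refine forall_congr' fun v => ?_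
    rw [← cast_degreeIn, Pi.zero_apply, ZMod.natCast_eq_zero_iff_even]
  constructor
  · rintro ⟨J, hJ, rfl⟩
    rw [← key]
    simpa using hJ
  · intro h
    exact ⟨({e | p e} : Finset G.edgeSet), (key _).2 h, by simp⟩

/-- The clutter of minimal `T`-joins of a graph is ideal (Edmonds and Johnson). -/
theorem isIdeal_minimalTJoins [Fintype V] [Fintype G.edgeSet] {T : Finset V}
    (hT : T.Nonempty) : IsIdeal (minimalTJoins G T) := by
  classical
  intro w
  by_cases hex : ∃ J, IsTJoin G T J
  swap
  · refine ⟨0, ⟨fun v => le_rfl, fun A hA => ?_⟩, fun v => ⟨0, by simp⟩, fun y hy => ?_⟩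
    · exact absurd ⟨A, hA.1⟩ hex
    · simp only [Pi.zero_apply, mul_zero, sum_const_zero]
      exact sum_nonneg fun v _ => mul_nonneg (Nat.cast_nonneg _) (hy.1 v)
  set s : G.edgeSet → V := fun e => edgeEnd e true with hs
  set t : G.edgeSet → V := fun e => edgeEnd e false with ht
  set τ : V → ZMod 2 := fun v => if v ∈ T then 1 else 0 with hτ
  obtain ⟨v₀, hv₀⟩ := hT
  -- A cheapest `T`-odd cut. For empty `T` there would be none: the empty set would be a member and
  -- the program infeasible.
  obtain ⟨U, hU, hUmin⟩ := exists_min_image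
    (univ.filter fun U : Finset V => ∑ v ∈ U, τ v = 1)
    (fun U => ∑ e ∈ cutEdges s t univ U, (w e : ℝ)) ⟨{v₀}, by simp [hτ, hv₀]⟩
  simp only [mem_filter, mem_univ, true_and] at hU hUmin
  refine ⟨fun e => if e ∈ cutEdges s t univ U then 1 else 0, ⟨fun e => ?_, fun A hA => ?_⟩,
    fun e => ?_, fun y hy => ?_⟩
  · dsimp only
    split_ifs <;> norm_num
  · have h1 := sum_boundary (s := s) (t := t) A U
    rw [show boundary s t A = τ from isTJoin_iff.1 hA.1, hU] at h1
    have h2 : ∑ e ∈ A, (if e ∈ cutEdges s t univ U then (1 : ℝ) else 0) =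
        #(cutEdges s t A U) := by
      rw [cutEdges, cutEdges, card_filter, Nat.cast_sum]
      exact sum_congr rfl fun e _ => by simp
    dsimp only
    rw [h2, Nat.one_le_cast, Nat.one_le_iff_ne_zero]
    intro h3
    rw [h3] at h1
    simp at h1
  · dsimp only
    split_ifs
    · exact ⟨1, by simp⟩
    · exact ⟨0, by simp⟩
  · have h1 : ∑ e, (w e : ℝ) * (if e ∈ cutEdges s t univ U then 1 else 0) =
        ∑ e ∈ cutEdges s t univ U, (w e : ℝ) := by
      simp [cutEdges, sum_filter]
    rw [h1]
    refine le_sum_mul_of_cuts (s := s) (t := t) (T := τ) (fun e => Nat.cast_nonneg _) hy.1 ?_ ?_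
      fun U' hU' => hUmin U' hU'
    · obtain ⟨J, hJ⟩ := hex
      exact ⟨J, isTJoin_iff.1 hJ⟩
    · intro J hJ
      obtain ⟨A, hAJ, hA⟩ := exists_minimal_le_of_wellFoundedLT (IsTJoin G T) J (isTJoin_iff.2 hJ)
      exact (hy.2 A hA).trans (sum_le_sum_of_subset_of_nonneg hAJ fun e _ _ => hy.1 e)

/-- In a connected graph, every vertex labelling with zero sum is a boundary. -/
lemma exists_graphBoundary_eq [Fintype V] (hG : G.Connected) {f : V → ZMod 2}
    (hf : ∑ v, f v = 0) : ∃ J : Finset G.edgeSet, graphBoundary J = f := by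
  classical
  obtain ⟨r⟩ := hG.nonempty
  have hpath : ∀ v, ∃ J : Finset G.edgeSet,
      graphBoundary J = Pi.single r 1 + Pi.single v 1 := by
    intro v
    obtain ⟨p⟩ := hG.preconnected v r
    induction p with
    | nil => exact ⟨∅, by rw [graphBoundary, boundary_empty, add_self_zmodTwo]⟩
    | @cons a b c hab p ih =>
      obtain ⟨J, hJ⟩ := ih
      have hb : graphBoundary {(⟨s(a, b), hab⟩ : G.edgeSet)} =
          Pi.single b 1 + Pi.single a 1 := by
        rw [graphBoundary, boundary_singleton]
        have h1 := mk_edgeEnd (⟨s(a, b), hab⟩ : G.edgeSet)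
        rw [Sym2.eq_iff] at h1
        rcases h1 with ⟨h1, h2⟩ | ⟨h1, h2⟩
        · rw [h1, h2, add_comm]
        · rw [h1, h2]
      refine ⟨symmDiff J {⟨s(a, b), hab⟩}, ?_⟩
      rw [graphBoundary_symmDiff, hJ, hb, add_comm (Pi.single c 1), single_add_cancel]
  have hset : ∀ S : Finset V, ∃ J : Finset G.edgeSet,
      graphBoundary J = ∑ v ∈ S, f v • (Pi.single r 1 + Pi.single v 1) := by
    intro S
    induction S using Finset.induction_on with
    | empty => exact ⟨∅, by rw [graphBoundary, boundary_empty, sum_empty]⟩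
    | insert v S hv ih =>
      obtain ⟨J, hJ⟩ := ih
      obtain ⟨K, hK⟩ := hpath v
      rw [sum_insert hv]
      have h2 : ∀ z : ZMod 2, z = 0 ∨ z = 1 := by decide
      rcases h2 (f v) with h | h
      · exact ⟨J, by rw [hJ, h, zero_smul, zero_add]⟩
      · exact ⟨symmDiff K J, by rw [graphBoundary_symmDiff, hJ, hK, h, one_smul]⟩
  obtain ⟨J, hJ⟩ := hset univ
  refine ⟨J, hJ.trans ?_⟩
  simp only [smul_add, sum_add_distrib, ← sum_smul, hf, zero_smul, zero_add]
  funext v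
  simp [Finset.sum_apply, Pi.single_apply]

end EdgeEnds

/-! ### `T`-joins of the subdivision as orientations -/

section Subdivision

variable {V : Type*} {G : SimpleGraph V}

/-- The edge of the subdivision that joins the new vertex `e` to one of the ends of `e`. -/
noncomputable def halfEdge (a : G.edgeSet × Bool) : (subdivision G).edgeSet :=
  ⟨s(.inl (edgeEnd a.1 a.2), .inr a.1), edgeEnd_mem a.1 a.2⟩

lemma halfEdge_bijective : Function.Bijective (halfEdge (G := G)) := by
  constructor
  · rintro ⟨e, b⟩ ⟨e', b'⟩ h
    have h1 := congrArg Subtype.val h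
    simp only [halfEdge, Sym2.eq_iff, Sum.inl.injEq, Sum.inr.injEq, reduceCtorEq, and_self,
      or_false] at h1
    obtain ⟨h1, rfl⟩ := h1
    rw [edgeEnd_injective e h1]
  · have key : ∀ (v : V) (e : G.edgeSet), v ∈ e.1 →
        ∃ a, (halfEdge a).1 = s(Sum.inl v, Sum.inr e) := by
      intro v e hve
      rcases mem_edge_iff.1 hve with rfl | rfl
      · exact ⟨(e, true), rfl⟩
      · exact ⟨(e, false), rfl⟩
    rintro ⟨z, hz⟩
    induction z using Sym2.ind with
    | _ x y =>
      rcases x with v | e <;> rcases y with v' | e'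
      · exact hz.elim
      · obtain ⟨a, ha⟩ := key v e' hz
        exact ⟨a, Subtype.ext ha⟩
      · obtain ⟨a, ha⟩ := key v' e hz
        exact ⟨a, Subtype.ext (ha.trans Sym2.eq_swap)⟩
      · exact hz.elim

/-- The edges of the subdivision are the pairs of an edge and one of its ends. -/
noncomputable def halfEdgeEquiv (G : SimpleGraph V) :
    G.edgeSet × Bool ≃ (subdivision G).edgeSet :=
  Equiv.ofBijective halfEdge halfEdge_bijective

lemma inl_mem_halfEdge {a : G.edgeSet × Bool} {v : V} :
    Sum.inl v ∈ (halfEdgeEquiv G a).1 ↔ v = edgeEnd a.1 a.2 := by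
  simp [halfEdgeEquiv, halfEdge]

lemma inr_mem_halfEdge {a : G.edgeSet × Bool} {e : G.edgeSet} :
    Sum.inr e ∈ (halfEdgeEquiv G a).1 ↔ e = a.1 := by
  simp [halfEdgeEquiv, halfEdge]

/-- The set of pairs `(e, p e)`. -/
def graphSet {E : Type*} [Fintype E] (p : E → Bool) : Finset (E × Bool) :=
  {x | p x.1 = x.2}

lemma mem_graphSet {E : Type*} [Fintype E] {p : E → Bool} {x : E × Bool} :
    x ∈ graphSet p ↔ p x.1 = x.2 := by
  simp [graphSet]

/-- The map `e ↦ (e, p e)`. -/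
def graphEmbedding {E : Type*} (p : E → Bool) : E ↪ E × Bool where
  toFun e := (e, p e)
  inj' _ _ h := (Prod.ext_iff.1 h).1

@[simp]
lemma graphEmbedding_apply {E : Type*} (p : E → Bool) (e : E) :
    graphEmbedding p e = (e, p e) := rfl

lemma graphSet_eq_map {E : Type*} [Fintype E] (p : E → Bool) :
    graphSet p = univ.map (graphEmbedding p) := by
  ext ⟨e, b⟩
  simp [mem_graphSet]

lemma eq_of_graphSet_subset {E : Type*} [Fintype E] {p q : E → Bool}
    (h : graphSet p ⊆ graphSet q) : p = q := by
  funext e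
  exact (mem_graphSet.1 (h (mem_graphSet.2 (rfl : p (e, p e).1 = _)))).symm

variable [DecidableEq V] [Fintype G.edgeSet]

/-- The labelling modulo two of the vertices by their indegrees in the orientation in which the
head of each edge `e` is the end of `e` selected by `p`. -/
noncomputable def indegree (p : G.edgeSet → Bool) : V → ZMod 2 :=
  ∑ e, Pi.single (edgeEnd e (p e)) 1

/-- Where the orientations agree, the two heads cancel; where they differ, both ends of the edge are
counted. -/
lemma indegree_add_indegree (p q : G.edgeSet → Bool) :
    indegree p + indegree q =
      graphBoundary ({e | (p e ^^ q e) = true} : Finset G.edgeSet) := by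
  rw [indegree, indegree, ← sum_add_distrib, graphBoundary, boundary, sum_filter]
  refine sum_congr rfl fun e _ => ?_
  cases p e <;> cases q e
  · simp [add_self_zmodTwo]
  · simp [add_comm]
  · simp
  · simp [add_self_zmodTwo]

lemma cast_degreeIn_graphSet (p : G.edgeSet → Bool) (v : V) :
    (degreeIn (subdivision G) ((graphSet p).map (halfEdgeEquiv G).toEmbedding) (.inl v) : ZMod 2) =
      indegree p v := by
  rw [degreeIn, filter_map, card_map, graphSet_eq_map, filter_map, card_map, card_filter,
    Nat.cast_sum, indegree, Finset.sum_apply]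
  refine sum_congr rfl fun e _ => ?_
  simp [inl_mem_halfEdge, Pi.single_apply]

/-- Odd degree at a new vertex, which has only two edges, means that exactly one half is chosen. The
conditions at the old vertices become indegree parities. -/
lemma isTJoin_subdivision_iff {T : Finset (V ⊕ G.edgeSet)} (hT : ∀ e, Sum.inr e ∈ T)
    {J : Finset (subdivision G).edgeSet} :
    IsTJoin (subdivision G) T J ↔
      ∃ p : G.edgeSet → Bool, J = (graphSet p).map (halfEdgeEquiv G).toEmbedding ∧
        indegree p = fun v => if Sum.inl v ∈ T then 1 else 0 := by
  classical
  obtain ⟨A, rfl⟩ : ∃ A : Finset (G.edgeSet × Bool), J = A.map (halfEdgeEquiv G).toEmbedding :=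
    ⟨J.map (halfEdgeEquiv G).symm.toEmbedding, by ext; simp⟩
  have hinl : ∀ p : G.edgeSet → Bool, (∀ v, (Odd (degreeIn (subdivision G)
      ((graphSet p).map (halfEdgeEquiv G).toEmbedding) (.inl v)) ↔ Sum.inl v ∈ T)) ↔
      indegree p = fun v => if Sum.inl v ∈ T then 1 else 0 := by
    intro p
    rw [funext_iff]
    refine forall_congr' fun v => ?_
    rw [← cast_degreeIn_graphSet]
    split_ifs with h
    · rw [ZMod.natCast_eq_one_iff_odd]; simp [h]
    · rw [ZMod.natCast_eq_zero_iff_even, ← Nat.not_odd_iff_even]; simp [h]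
  have hinr : ∀ e, degreeIn (subdivision G) (A.map (halfEdgeEquiv G).toEmbedding) (.inr e) =
      (if (e, true) ∈ A then 1 else 0) + (if (e, false) ∈ A then 1 else 0) := by
    intro e
    have h1 : ({a ∈ A | e = a.1} : Finset _) =
        ({(e, true), (e, false)} : Finset _).filter (· ∈ A) := by
      ext ⟨e', b⟩
      cases b <;> simp [and_comm, eq_comm]
    rw [degreeIn, filter_map, card_map]
    simp only [Function.comp_def, Equiv.coe_toEmbedding, inr_mem_halfEdge]
    rw [h1, card_filter, sum_pair (by simp)]
  constructor
  · intro h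
    have hA : A = graphSet fun e => decide ((e, true) ∈ A) := by
      ext ⟨e, b⟩
      rw [mem_graphSet]
      have h1 := (h (.inr e)).2 (hT e)
      rw [hinr] at h1
      by_cases h2 : (e, true) ∈ A <;> by_cases h3 : (e, false) ∈ A <;>
        simp [h2, h3, Nat.odd_iff] at h1 <;> cases b <;> simp [h2, h3]
    refine ⟨_, congrArg _ hA, (hinl _).1 ?_⟩
    rw [← hA]
    exact fun v => h _
  · rintro ⟨p, hp, hind⟩
    rw [map_inj] at hp
    subst hp
    rintro (v | e)
    · exact (hinl p).2 hind v
    · rw [hinr]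
      simp only [mem_graphSet, hT e, iff_true]
      cases p e <;> simp

lemma mem_minimalTJoins_subdivision_iff {T : Finset (V ⊕ G.edgeSet)} (hT : ∀ e, Sum.inr e ∈ T)
    {J : Finset (subdivision G).edgeSet} :
    J ∈ minimalTJoins (subdivision G) T ↔
      ∃ p : G.edgeSet → Bool, J = (graphSet p).map (halfEdgeEquiv G).toEmbedding ∧
        indegree p = fun v => if Sum.inl v ∈ T then 1 else 0 := by
  refine ⟨fun h => (isTJoin_subdivision_iff hT).1 h.1,
    fun h => ⟨(isTJoin_subdivision_iff hT).2 h, fun J' hJ' hle => ?_⟩⟩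
  obtain ⟨p, rfl, -⟩ := h
  obtain ⟨q, rfl, -⟩ := (isTJoin_subdivision_iff hT).1 hJ'
  rw [eq_of_graphSet_subset (map_subset_map.1 hle)]

/-- Flipping the second component over each `e` with `d e = true`. -/
def flipEquiv {E : Type*} (d : E → Bool) : E × Bool ≃ E × Bool where
  toFun x := (x.1, x.2 ^^ d x.1)
  invFun x := (x.1, x.2 ^^ d x.1)
  left_inv x := by simp
  right_inv x := by simp

lemma map_flipEquiv_graphSet {E : Type*} [Fintype E] (p d : E → Bool) :
    (graphSet p).map (flipEquiv d).toEmbedding = graphSet fun e => p e ^^ d e := by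
  ext ⟨e, b⟩
  rw [mem_map_equiv, mem_graphSet, mem_graphSet]
  simp only [flipEquiv, Equiv.coe_fn_symm_mk]
  cases p e <;> cases d e <;> cases b <;> simp

/-- The indegrees of any orientation sum to the number of edges, which has the parity of the number
of old vertices in `T`. The discrepancy of a fixed orientation thus has zero sum, so it is the
boundary of some `J`; reversing `J` corrects it. -/
lemma exists_indegree_eq [Fintype V] (hG : G.Connected) {T : Finset (V ⊕ G.edgeSet)}
    (hT : Even #T) (hTe : ∀ e, Sum.inr e ∈ T) :
    ∃ p : G.edgeSet → Bool, indegree p = fun v => if Sum.inl v ∈ T then 1 else 0 := by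
  classical
  have h1 : ∑ v, (indegree (fun _ : G.edgeSet => true) +
      fun v => if Sum.inl v ∈ T then (1 : ZMod 2) else 0) v = 0 := by
    have h2 : #T = ∑ x, if x ∈ T then 1 else 0 := by simp
    rw [Fintype.sum_sum_type] at h2
    rw [← ZMod.natCast_eq_zero_iff_even, h2] at hT
    push_cast at hT
    simp only [hTe, if_true] at hT
    have h3 : ∑ v, indegree (fun _ : G.edgeSet => true) v = ∑ _e : G.edgeSet, (1 : ZMod 2) := by
      simp only [indegree, Finset.sum_apply]
      rw [sum_comm]
      exact sum_congr rfl fun e _ => by simp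
    simp_rw [Pi.add_apply]
    rw [sum_add_distrib, h3, add_comm, hT]
  obtain ⟨J, hJ⟩ := exists_graphBoundary_eq hG h1
  refine ⟨fun e => true ^^ decide (e ∈ J), ?_⟩
  have h2 := indegree_add_indegree (fun _ : G.edgeSet => true)
    fun e => true ^^ decide (e ∈ J)
  have h3 : ({e | (true ^^ (true ^^ decide (e ∈ J))) = true} : Finset G.edgeSet) = J := by
    ext; simp
  rw [h3, hJ] at h2
  exact add_left_cancel h2

/-- If `T` has even size and contains the new vertices, then the clutter of the minimal `T`-joins of
the subdivision of a connected graph is the cuboid of the cycle space, up to relabelling. -/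
theorem isRelabelling_minimalTJoins_cuboid [Fintype V] (hG : G.Connected)
    {T : Finset (V ⊕ G.edgeSet)} (hT : Even #T) (hTe : ∀ e, Sum.inr e ∈ T) :
    IsRelabelling (minimalTJoins (subdivision G) T) (cuboid (cycleSpace G)) := by
  obtain ⟨d, hd⟩ := exists_indegree_eq hG hT hTe
  have hmap : ∀ p : G.edgeSet → Bool,
      ((graphSet p).map (halfEdgeEquiv G).toEmbedding).map
        ((halfEdgeEquiv G).symm.trans (flipEquiv d)).toEmbedding =
      graphSet fun e => p e ^^ d e := by
    intro p
    rw [← map_flipEquiv_graphSet, map_map]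
    congr 1
    ext x <;> simp
  have hcyc : ∀ p : G.edgeSet → Bool, (fun e => p e ^^ d e) ∈ cycleSpace G ↔
      indegree p = indegree d := by
    intro p
    rw [mem_cycleSpace_iff, ← indegree_add_indegree]
    constructor
    · intro h
      rw [← add_zero (indegree p), ← add_self_zmodTwo (indegree d), ← add_assoc, h, zero_add]
    · intro h
      rw [h, add_self_zmodTwo]
  refine ⟨(halfEdgeEquiv G).symm.trans (flipEquiv d), ?_⟩
  ext A
  constructor
  · rintro ⟨p, hp, rfl⟩
    refine ⟨_, (mem_minimalTJoins_subdivision_iff hTe).2 ⟨fun e => p e ^^ d e, rfl, ?_⟩, ?_⟩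
    · rw [← hd, ← hcyc]
      simpa using hp
    · refine (hmap _).trans ?_
      simp [graphSet]
  · rintro ⟨J, hJ, rfl⟩
    obtain ⟨p, rfl, hp⟩ := (mem_minimalTJoins_subdivision_iff hTe).1 hJ
    exact ⟨_, (hcyc p).2 (hp.trans hd.symm), hmap p⟩

end Subdivision

/-! ### Cuboids: binarity and the 3-wise intersection criterion -/

section Cuboid

lemma mem_cuboid {E : Type*} [Fintype E] {S : Set (E → Bool)} {A : Finset (E × Bool)} :
    A ∈ cuboid S ↔ ∃ p ∈ S, A = graphSet p := Iff.rfl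

lemma isClutter_cuboid {E : Type*} [Fintype E] (S : Set (E → Bool)) : IsClutter (cuboid S) := by
  rintro _ ⟨p, -, rfl⟩ _ ⟨q, -, rfl⟩ hne hle
  exact hne (congrArg graphSet (eq_of_graphSet_subset hle))

variable {V : Type*} [DecidableEq V] {G : SimpleGraph V} [Fintype G.edgeSet]

/-- The sum of the cycles is a cycle. As `#D` is odd, exactly one of `(e, true)` and `(e, false)`
lies in an odd number of members. -/
theorem isBinary_cuboid_cycleSpace [DecidableEq G.edgeSet] :
    IsBinary (cuboid (cycleSpace G)) := by
  intro D hD hodd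
  set q : G.edgeSet → Bool := fun e => decide (Odd #{A ∈ D | (e, true) ∈ A}) with hq
  refine ⟨graphSet q, ⟨q, ?_, rfl⟩, ?_⟩
  · rw [mem_cycleSpace_iff]
    have h1 : graphBoundary ({e | q e} : Finset G.edgeSet) =
        ∑ A ∈ D, graphBoundary ({e | (e, true) ∈ A} : Finset G.edgeSet) := by
      simp only [graphBoundary, boundary, sum_filter]
      rw [sum_comm]
      refine sum_congr rfl fun e _ => ?_
      rw [← sum_filter, sum_const]
      funext v
      rw [Pi.smul_apply, nsmul_eq_mul]
      by_cases h : Odd #{A ∈ D | (e, true) ∈ A}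
      · have h2 := ZMod.natCast_eq_one_iff_odd.2 h
        simp [hq, h, h2]
      · have h2 := ZMod.natCast_eq_zero_iff_even.2 (Nat.not_odd_iff_even.1 h)
        simp [hq, h, h2]
    rw [h1]
    refine sum_eq_zero fun A hA => ?_
    obtain ⟨p, hp, rfl⟩ := mem_cuboid.1 (hD hA)
    rw [mem_cycleSpace_iff] at hp
    simpa only [mem_graphSet] using hp
  · rintro ⟨e, b⟩ h
    rw [mem_graphSet] at h
    simp only [symmDiffAll, mem_filter, mem_univ, true_and]
    cases b
    · have h1 : Even #{A ∈ D | (e, true) ∈ A} := by simpa [hq] using h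
      have h2 : ({A ∈ D | (e, false) ∈ A} : Finset _) = {A ∈ D | ¬ (e, true) ∈ A} := by
        refine filter_congr fun A hA => ?_
        obtain ⟨p, -, rfl⟩ := mem_cuboid.1 (hD hA)
        simp [mem_graphSet]
      rw [h2]
      rw [← card_filter_add_card_filter_not (s := D) (fun A => (e, true) ∈ A)] at hodd
      exact (Nat.odd_add'.1 hodd).2 h1
    · simpa [hq] using h

/-- The cuboid of a set of points is `3`-wise intersecting if any three points agree in some
coordinate, and no coordinate is constant. -/
lemma isKWiseIntersecting_three_cuboid {E : Type*} [Fintype E] {S : Set (E → Bool)}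
    (hne : S.Nonempty)
    (h3 : ∀ p ∈ S, ∀ q ∈ S, ∀ r ∈ S, ∃ e, p e = q e ∧ p e = r e)
    (hc : ∀ e b, ∃ p ∈ S, p e ≠ b) : IsKWiseIntersecting 3 (cuboid S) := by
  classical
  constructor
  · intro D hD hcard
    have key : ∃ A ∈ cuboid S, ∃ B ∈ cuboid S, ∃ C ∈ cuboid S, D ⊆ {A, B, C} := by
      obtain ⟨p, hp⟩ := hne
      have hP : graphSet p ∈ cuboid S := ⟨p, hp, rfl⟩
      have h : #D = 0 ∨ #D = 1 ∨ #D = 2 ∨ #D = 3 := by omega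
      rcases h with h | h | h | h
      · exact ⟨_, hP, _, hP, _, hP, by rw [card_eq_zero.1 h]; exact empty_subset _⟩
      · obtain ⟨A, rfl⟩ := card_eq_one.1 h
        have hA : A ∈ cuboid S := hD (by simp)
        exact ⟨A, hA, A, hA, A, hA, by simp⟩
      · obtain ⟨A, B, -, rfl⟩ := card_eq_two.1 h
        have hA : A ∈ cuboid S := hD (by simp)
        have hB : B ∈ cuboid S := hD (by simp)
        exact ⟨A, hA, A, hA, B, hB, by simp⟩
      · obtain ⟨A, B, C, -, -, -, rfl⟩ := card_eq_three.1 h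
        exact ⟨A, hD (by simp), B, hD (by simp), C, hD (by simp), subset_rfl⟩
    obtain ⟨_, ⟨p, hp, rfl⟩, _, ⟨q, hq, rfl⟩, _, ⟨r, hr, rfl⟩, hsub⟩ := key
    obtain ⟨e, he1, he2⟩ := h3 p hp q hq r hr
    refine ⟨(e, p e), fun A hA => ?_⟩
    have := hsub hA
    simp only [mem_insert, mem_singleton] at this
    rcases this with rfl | rfl | rfl
    · simp
    · simp [he1]
    · simp [he2]
  · rintro ⟨⟨e, b⟩, h⟩
    obtain ⟨p, hp, hpe⟩ := hc e b
    exact hpe (mem_graphSet.1 (h _ ⟨p, hp, rfl⟩))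

lemma xor_eq_false_of_mem_cycleSpace {v : V} {e₁ e₂ e₃ : G.edgeSet} (h12 : e₁ ≠ e₂) (h13 : e₁ ≠ e₃)
    (h23 : e₂ ≠ e₃) (h : ∀ e : G.edgeSet, v ∈ e.1 ↔ e = e₁ ∨ e = e₂ ∨ e = e₃)
    {p : G.edgeSet → Bool} (hp : p ∈ cycleSpace G) : (p e₁ ^^ p e₂ ^^ p e₃) = false := by
  classical
  obtain ⟨J, hJ, rfl⟩ := hp
  have h1 := hJ v
  have h2 : J.filter (fun e => v ∈ e.1) = ({e₁, e₂, e₃} : Finset G.edgeSet).filter (· ∈ J) := by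
    ext e
    simp only [mem_filter, h, mem_insert, mem_singleton]
    tauto
  rw [degreeIn, h2, card_filter, sum_insert (by simp [h12, h13]), sum_pair h23] at h1
  by_cases hJ1 : e₁ ∈ J <;> by_cases hJ2 : e₂ ∈ J <;> by_cases hJ3 : e₃ ∈ J <;>
    simp [hJ1, hJ2, hJ3, Nat.even_iff] at h1 ⊢

end Cuboid

/-! ### The Petersen graph -/

section Petersen

/-- The edge of the outer cycle from `(false, i)` to `(false, i + 1)`. -/
def outerEdge (i : Fin 5) : petersen.edgeSet :=
  ⟨s((false, i), (false, i + 1)), by revert i; decide⟩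

/-- The edge of the inner pentagram from `(true, i)` to `(true, i + 2)`. -/
def innerEdge (i : Fin 5) : petersen.edgeSet :=
  ⟨s((true, i), (true, i + 2)), by revert i; decide⟩

/-- The edge from `(false, i)` to `(true, i)`. -/
def spoke (i : Fin 5) : petersen.edgeSet :=
  ⟨s((false, i), (true, i)), by revert i; decide⟩

lemma mem_petersen_edge_iff {v w₁ w₂ w₃ : Bool × Fin 5}
    (hv : ∀ w, petersen.Adj v w ↔ w = w₁ ∨ w = w₂ ∨ w = w₃) {e₁ e₂ e₃ : petersen.edgeSet}
    (h₁ : e₁.1 = s(v, w₁)) (h₂ : e₂.1 = s(v, w₂)) (h₃ : e₃.1 = s(v, w₃)) (e : petersen.edgeSet) :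
    v ∈ e.1 ↔ e = e₁ ∨ e = e₂ ∨ e = e₃ := by
  constructor
  · rintro ⟨w, hw⟩
    have h : petersen.Adj v w := by
      rw [← SimpleGraph.mem_edgeSet, ← hw]
      exact e.2
    simp only [Subtype.ext_iff, h₁, h₂, h₃, hw]
    rcases (hv w).1 h with rfl | rfl | rfl <;> simp
  · rintro (rfl | rfl | rfl)
    · rw [h₁]; exact Sym2.mem_mk_left _ _
    · rw [h₂]; exact Sym2.mem_mk_left _ _
    · rw [h₃]; exact Sym2.mem_mk_left _ _

lemma cycleSpace_petersen_outer {p : petersen.edgeSet → Bool} (hp : p ∈ cycleSpace petersen)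
    (i : Fin 5) : (p (outerEdge i) ^^ p (outerEdge (i - 1)) ^^ p (spoke i)) = false := by
  have h1 : ∀ i w, petersen.Adj (false, i) w ↔
      w = (false, i + 1) ∨ w = (false, i - 1) ∨ w = (true, i) := by decide
  refine xor_eq_false_of_mem_cycleSpace ?_ ?_ ?_ (mem_petersen_edge_iff (h1 i) rfl ?_ rfl) hp <;>
    revert i <;> decide

lemma cycleSpace_petersen_inner {p : petersen.edgeSet → Bool} (hp : p ∈ cycleSpace petersen)
    (i : Fin 5) : (p (innerEdge i) ^^ p (innerEdge (i - 2)) ^^ p (spoke i)) = false := by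
  have h1 : ∀ i w, petersen.Adj (true, i) w ↔
      w = (true, i + 2) ∨ w = (true, i - 2) ∨ w = (false, i) := by decide
  refine xor_eq_false_of_mem_cycleSpace ?_ ?_ ?_ (mem_petersen_edge_iff (h1 i) rfl ?_ ?_) hp <;>
    revert i <;> decide

lemma petersen_edge_cases (e : petersen.edgeSet) :
    ∃ i, e = outerEdge i ∨ e = innerEdge i ∨ e = spoke i := by
  obtain ⟨z, hz⟩ := e
  induction z using Sym2.ind with
  | _ x y =>
    have h : ∀ x y, petersen.Adj x y → ∃ i, s(x, y) = (outerEdge i).1 ∨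
        s(x, y) = (innerEdge i).1 ∨ s(x, y) = (spoke i).1 := by decide +kernel
    simpa only [Subtype.ext_iff] using h x y hz

/-- The incidence vector of a cycle of the Petersen graph, given by its values on all edges of the
outer cycle and one edge of the pentagram. -/
def petersenCycle (a b c d e n : Bool) : Fin 15 → Bool :=
  let n₂ := n ^^ (c ^^ b)
  let n₄ := n₂ ^^ (e ^^ d)
  let n₁ := n₄ ^^ (b ^^ a)
  ![a, b, c, d, e, n, n₁, n₂, n₁ ^^ (d ^^ c), n₄, a ^^ e, b ^^ a, c ^^ b, d ^^ c, e ^^ d]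

lemma petersenCycle_or_petersenCycle : ∀ a b c d e n a' b' c' d' e' n' : Bool,
    ∃ i, (petersenCycle a b c d e n i || petersenCycle a' b' c' d' e' n' i) = false := by
  decide +kernel

/-- The edges of the Petersen graph in the order used by `petersenCycle`. -/
def petersenEdge : Fin 15 → petersen.edgeSet :=
  ![outerEdge 0, outerEdge 1, outerEdge 2, outerEdge 3, outerEdge 4,
    innerEdge 0, innerEdge 1, innerEdge 2, innerEdge 3, innerEdge 4,
    spoke 0, spoke 1, spoke 2, spoke 3, spoke 4]

lemma apply_petersenEdge {p : petersen.edgeSet → Bool} (hp : p ∈ cycleSpace petersen)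
    (i : Fin 15) :
    p (petersenEdge i) = petersenCycle (p (outerEdge 0)) (p (outerEdge 1)) (p (outerEdge 2))
      (p (outerEdge 3)) (p (outerEdge 4)) (p (innerEdge 0)) i := by
  have key : ∀ {x y z : Bool}, (x ^^ y ^^ z) = false → z = (x ^^ y) := by decide
  have key' : ∀ {x y z : Bool}, (x ^^ y ^^ z) = false → x = (y ^^ z) := by decide
  have ho := fun i => key (cycleSpace_petersen_outer hp i)
  have hn := fun i => key' (cycleSpace_petersen_inner hp i)
  have o0 : p (spoke 0) = (p (outerEdge 0) ^^ p (outerEdge 4)) := ho 0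
  have o1 : p (spoke 1) = (p (outerEdge 1) ^^ p (outerEdge 0)) := ho 1
  have o2 : p (spoke 2) = (p (outerEdge 2) ^^ p (outerEdge 1)) := ho 2
  have o3 : p (spoke 3) = (p (outerEdge 3) ^^ p (outerEdge 2)) := ho 3
  have o4 : p (spoke 4) = (p (outerEdge 4) ^^ p (outerEdge 3)) := ho 4
  -- The pentagram is traversed in the order 0, 2, 4, 1, 3, so each inner edge follows from the
  -- previous one and a spoke.
  have n2 : p (innerEdge 2) = (p (innerEdge 0) ^^ p (spoke 2)) := hn 2
  have n4 : p (innerEdge 4) = (p (innerEdge 2) ^^ p (spoke 4)) := hn 4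
  have n1 : p (innerEdge 1) = (p (innerEdge 4) ^^ p (spoke 1)) := hn 1
  have n3 : p (innerEdge 3) = (p (innerEdge 1) ^^ p (spoke 3)) := hn 3
  rw [o2] at n2
  rw [n2, o4] at n4
  rw [n4, o1] at n1
  rw [n1, o3] at n3
  fin_cases i
  exacts [rfl, rfl, rfl, rfl, rfl, rfl, n1, n2, n3, n4, o0, o1, o2, o3, o4]

/-- The edge set of the Petersen graph is not the union of two cycles; equivalently, there is no
3-edge-colouring. -/
lemma exists_notMem_two_cycles {p q : petersen.edgeSet → Bool} (hp : p ∈ cycleSpace petersen)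
    (hq : q ∈ cycleSpace petersen) : ∃ e, (p e || q e) = false := by
  obtain ⟨i, hi⟩ := petersenCycle_or_petersenCycle (p (outerEdge 0)) (p (outerEdge 1))
    (p (outerEdge 2)) (p (outerEdge 3)) (p (outerEdge 4)) (p (innerEdge 0)) (q (outerEdge 0))
    (q (outerEdge 1)) (q (outerEdge 2)) (q (outerEdge 3)) (q (outerEdge 4)) (q (innerEdge 0))
  rw [← apply_petersenEdge hp, ← apply_petersenEdge hq] at hi
  exact ⟨_, hi⟩

lemma xor_mem_cycleSpace {V : Type*} [DecidableEq V] {G : SimpleGraph V} [Fintype G.edgeSet]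
    {p q : G.edgeSet → Bool} (hp : p ∈ cycleSpace G) (hq : q ∈ cycleSpace G) :
    (fun e => p e ^^ q e) ∈ cycleSpace G := by
  classical
  rw [mem_cycleSpace_iff] at *
  have h : ({e | (p e ^^ q e) = true} : Finset G.edgeSet) =
      symmDiff ({e | p e} : Finset G.edgeSet) ({e | q e} : Finset G.edgeSet) := by
    ext e
    simp only [mem_filter, mem_univ, true_and, mem_symmDiff]
    cases p e <;> cases q e <;> simp
  rw [h, graphBoundary_symmDiff, hp, hq, add_zero]

/-- A 5-cycle of the Petersen graph through one edge of the outer cycle, two spokes and two edges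
of the pentagram. -/
def petersenPentagon (i : Fin 5) : Finset petersen.edgeSet :=
  {outerEdge i, spoke (i + 1), innerEdge (i + 1), innerEdge (i + 3), spoke i}

lemma even_degreeIn_petersenPentagon : ∀ i v, Even (degreeIn petersen (petersenPentagon i) v) := by
  decide +kernel

theorem isKWiseIntersecting_cuboid_petersen :
    IsKWiseIntersecting 3 (cuboid (cycleSpace petersen)) := by
  have h0 : (fun _ => false) ∈ cycleSpace petersen := ⟨∅, fun v => by simp [degreeIn], by simp⟩
  refine isKWiseIntersecting_three_cuboid ⟨_, h0⟩ (fun p hp q hq r hr => ?_) fun e b => ?_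
  · obtain ⟨e, he⟩ := exists_notMem_two_cycles (xor_mem_cycleSpace hp hq)
      (xor_mem_cycleSpace hp hr)
    exact ⟨e, by simpa using he⟩
  · cases b
    · have h1 : ∃ i, e ∈ petersenPentagon i := by
        obtain ⟨i, rfl | rfl | rfl⟩ := petersen_edge_cases e
        · exact ⟨i, by simp [petersenPentagon]⟩
        · exact ⟨i - 1, by simp [petersenPentagon]⟩
        · exact ⟨i, by simp [petersenPentagon]⟩
      obtain ⟨i, hi⟩ := h1
      exact ⟨_, ⟨petersenPentagon i, even_degreeIn_petersenPentagon i, rfl⟩, by simpa using hi⟩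
    · exact ⟨_, h0, by simp⟩

lemma connected_petersen : petersen.Connected := by
  have h : ∀ i, petersen.Reachable (false, 0) (false, i) := by
    have hs : ∀ i, petersen.Reachable (false, 0) (false, i) →
        petersen.Reachable (false, 0) (false, i + 1) := fun i hi =>
      hi.trans (SimpleGraph.Adj.reachable (outerEdge i).2)
    have h0 : petersen.Reachable (false, 0) (false, 0) := SimpleGraph.Reachable.refl _
    have h1 := hs 0 h0
    have h2 := hs 1 h1
    have h3 := hs 2 h2
    have h4 := hs 3 h3
    intro i
    fin_cases i <;> assumption
  have h' : ∀ v, petersen.Reachable (false, 0) v := by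
    rintro ⟨_ | _, i⟩
    · exact h i
    · exact (h i).trans (SimpleGraph.Adj.reachable (spoke i).2)
  exact ⟨fun u v => (h' u).symm.trans (h' v)⟩

theorem isIdeal_cuboid_petersen : IsIdeal (cuboid (cycleSpace petersen)) := by
  obtain ⟨T, hT, hTe⟩ : ∃ T : Finset ((Bool × Fin 5) ⊕ petersen.edgeSet), Even #T ∧
      ∀ e, Sum.inr e ∈ T := by
    set T₀ : Finset ((Bool × Fin 5) ⊕ petersen.edgeSet) := univ.map Function.Embedding.inr
    by_cases h : Even #T₀
    · exact ⟨T₀, h, fun e => by simp [T₀]⟩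
    -- Any old vertex repairs the parity of the set of new vertices.
    · refine ⟨cons (.inl (false, 0)) T₀ (by simp [T₀]), ?_, fun e => by simp [T₀]⟩
      rw [card_cons]
      exact (Nat.not_even_iff_odd.1 h).add_one
  exact (isRelabelling_minimalTJoins_cuboid connected_petersen hT hTe).isIdeal
    (isIdeal_minimalTJoins ⟨_, hTe (spoke 0)⟩)

end Petersen

end Clutters

theorem proposition1p4 :
    -- an ideal 3-wise intersecting binary clutter exists
    (∃ (V : Type) (_ : Fintype V) (_ : DecidableEq V) (C : Set (Finset V)),
      Clutters.IsClutter C ∧ Clutters.IsIdeal C ∧ Clutters.IsKWiseIntersecting 3 C ∧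
        Clutters.IsBinary C) ∧
    -- the cuboid of the cycle space of the Petersen graph is one
    (Clutters.IsClutter (Clutters.cuboid (Clutters.cycleSpace Clutters.petersen)) ∧
      Clutters.IsIdeal (Clutters.cuboid (Clutters.cycleSpace Clutters.petersen)) ∧
      Clutters.IsKWiseIntersecting 3
        (Clutters.cuboid (Clutters.cycleSpace Clutters.petersen)) ∧
      Clutters.IsBinary (Clutters.cuboid (Clutters.cycleSpace Clutters.petersen))) ∧
    -- this cuboid is the clutter T30 of minimal T-joins of the subdivided Petersen graph
    (∀ T : Finset ((Bool × Fin 5) ⊕ Clutters.petersen.edgeSet), Even T.card →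
      (∀ e : Clutters.petersen.edgeSet, Sum.inr e ∈ T) →
      Clutters.IsRelabelling
        (Clutters.minimalTJoins (Clutters.subdivision Clutters.petersen) T)
        (Clutters.cuboid (Clutters.cycleSpace Clutters.petersen))) ∧
    -- "every 4-wise intersecting binary clutter is non-ideal" fails with 3 in place of 4
    ¬ ∀ (V : Type) [Fintype V] [DecidableEq V] (C : Set (Finset V)),
      Clutters.IsClutter C → Clutters.IsKWiseIntersecting 3 C → Clutters.IsBinary C →
        ¬ Clutters.IsIdeal C := by
  have hclutter := Clutters.isClutter_cuboid (Clutters.cycleSpace Clutters.petersen)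
  have hideal := Clutters.isIdeal_cuboid_petersen
  have hint := Clutters.isKWiseIntersecting_cuboid_petersen
  have hbinary := Clutters.isBinary_cuboid_cycleSpace (G := Clutters.petersen)
  exact ⟨⟨_, _, _, _, hclutter, hideal, hint, hbinary⟩, ⟨hclutter, hideal, hint, hbinary⟩,
    fun T hT hTe =>
      Clutters.isRelabelling_minimalTJoins_cuboid Clutters.connected_petersen hT hTe,
    fun h => h _ _ hclutter hint hbinary hideal⟩
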